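/- **Subdivision rules.** A (colored) finite subdivision rule $R$ of dimension $N$ consists of the following. (1) A finite $N$-dimensional (Hausdorff) CW complex $S_R$ that is the union of its closed $N$-cells. For each closed $N$-cell $\tilde s$ there are a CW structure $s$ on the closed $N$-disk, whose only $N$-cell is the interior of the disk and whose other cells lie in the boundary, in which any two different closed cells that intersect do so in a single closed cell of lower dimension, and a continuous map $\psi_s:s\to S_R$ with image $\tilde s$, taking the interior of the disk onto the open cell of $\tilde s$, that restricts on each open cell to a homeomorphism onto an open cell of the same dimension. (2) A subdivision $R(S_R)$ of $S_R$: a finite CW structure on the same space, again the union of its closed $N$-cells and of dimension $N$, each of whose open cells lies in an open cell of $S_R$. (3) A partition of the tiles ($N$-cells) of $S_R$ into ideal and non-ideal ones. (4) A continuous cellular map $\phi_R:R(S_R)\to S_R$ that maps each open cell homeomorphically onto an open cell of the same dimension, and maps the union of the closed ideal tiles into itself. An $R$-complex is an $N$-dimensional (Hausdorff) CW complex $X$ that is the union of its closed $N$-cells, with a continuous cellular map $f:X\to S_R$ mapping each open cell homeomorphically onto an open cell of the same dimension. Put $R^0(X)=X$, and let $R^{n+1}(X)$ be the subdivision of $R^n(X)$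 obtained by pulling back the cell structure of $R(S_R)$ to the cells of $R^n(X)$ along $\phi_R^n\circ f$. A tile of $R^n(X)$ is an $N$-cell; it is ideal or non-ideal according to the tile of $S_R$ onto which $\phi_R^n\circ f$ maps it. **Limit set and history graph.** Let $\Lambda_n$ be the union of the closed non-ideal tiles of $R^n(X)$. The ideal set $\Omega$ is the union over $n$ of the interiors in $X$ of the union of the closed ideal tiles of $R^n(X)$, and the limit set is $\Lambda=X\setminus\Omega$ (it follows that $\Lambda=\bigcap_n\Lambda_n$ if $X$ is finite). $\Gamma_n$ is the graph whose vertices are the cells (of all dimensions) of $\Lambda_n$, two different cells being adjacent if one lies in the closure of the other; $d_n$ is its path metric, with value $\infty$ between different components. The history graph $\Gamma=\Gamma(R,X)$ is the disjoint union of the $\Gamma_n$ $(n\ge 0)$ and a vertex $O$ (the origin), with additional edges joining $O$ to each vertex of $\Gamma_0$ and each open cell of $\Lambda_n$ to the open cells of $\Lambda_{n+1}$ contained in it. For $x\in\Lambda$ let $f_n(x)\in\Gamma_n$ be the cell whose open cell contains $x$, and for $m\le n$ let $f_{m,n}:\Gamma_n\to\Gamma_m$ send a cell to the cell of $\Lambda_m$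 whose open cell contains it. $R$ is hyperbolic with respect to $X$ if there are positive integers $M,j$ such that for all $n\ge0$ and all vertices $x,y$ of $\Gamma_{n+j}$ with $d_{n+j}(x,y)<\infty$ and $d_n(f_{n,n+j}(x),f_{n,n+j}(y))\ge M$ one has $d_{n+j}(x,y)>d_n(f_{n,n+j}(x),f_{n,n+j}(y))$. The canonical quotient $\widehat\Lambda$ is the quotient space of $\Lambda$ by the equivalence relation: $x\sim y$ if $d_n(f_n(x),f_n(y))$ is bounded as $n\to\infty$. The combinatorial diameter of $F\subseteq\Lambda$ in $\Lambda_n$ is $\sup_{x,y\in F}d_n(f_n(x),f_n(y))$. **Hyperbolicity and boundary.** Let $d$ be the path metric on the vertices of $\Gamma$, and let $(x,y)_p=\frac12(d(p,x)+d(p,y)-d(x,y))$. For $\delta>0$, $\Gamma$ is $\delta$-hyperbolic if $(x,z)_p>\min\{(x,y)_p,(y,z)_p\}-\delta$ for all vertices $x,y,z,p$. The Gromov boundary $\partial\Gamma$ is the set of geodesic rays $\gamma$ from $O$ (given by their vertices $\gamma(0)=O,\gamma(1),\gamma(2),\dots$), two rays $\gamma,\nu$ being identified if $(\gamma(t),\nu(t))_O\to\infty$.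 For a ray $\gamma$ and $r\in\mathbb R$ let $U(\gamma,r)$ be the set of the points of $\partial\Gamma$ that have a representative $\nu$ with $(\gamma(t),\nu(t))_O\ge r$ for all sufficiently large $t$. A set $W\subseteq\partial\Gamma$ is open if for every ray $\gamma$ with $[\gamma]\in W$ there is an $r$ with $U(\gamma,r)\subseteq W$. **Theorem.** Let $R$ be a finite subdivision rule and let $X$ be a finite $R$-complex. If $\Gamma(R,X)$ is $\delta$-hyperbolic, then: 1. $R$ is hyperbolic with respect to $X$; 2. the canonical quotient $\widehat\Lambda$ is homeomorphic to the Gromov boundary $\partial\Gamma$; 3. the preimage in $\Lambda$ of each point of $\widehat\Lambda$ is connected, and its combinatorial diameter in each $\Lambda_n$ is at most $\delta+1$. -/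

import Mathlib

open Set Filter Topology Metric

universe u v

noncomputable section

/-! ### CW complexes and maps that are homeomorphisms on open cells -/

section CW

variable {A : Type u} [TopologicalSpace A] {C : Set A}

/-- The `k`-dimensional cells of a CW structure `c`. -/
abbrev CWCell (c : CWComplex C) (k : ℕ) : Type u :=
  @RelCWComplex.cell A _ C ∅ c.instRelCWComplex k

/-- The open cell `i` of a CW structure `c`. -/
def cwOpenCell (c : CWComplex C) (k : ℕ) (i : CWCell c k) : Set A :=
  @RelCWComplex.openCell A _ C ∅ c.instRelCWComplex k i

/-- The closed cell `i` of a CW structure `c`. -/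
def cwClosedCell (c : CWComplex C) (k : ℕ) (i : CWCell c k) : Set A :=
  @RelCWComplex.closedCell A _ C ∅ c.instRelCWComplex k i

/-- The CW structure `c` has finitely many cells. -/
def IsFiniteCW (c : CWComplex C) : Prop :=
  @RelCWComplex.Finite A _ C ∅ c.instRelCWComplex

/-- `c` is a CW structure of dimension at most `N` on the whole space, and the space is the union
of the closed `N`-cells. -/
def IsPureCW (c : CWComplex (univ : Set A)) (N : ℕ) : Prop :=
  (∀ k, N < k → IsEmpty (CWCell c k)) ∧ (⋃ i : CWCell c N, cwClosedCell c N i) = univ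

/-- `c'` is a subdivision of `c`: every open cell of `c'` lies in an open cell of `c` (hence every
open cell of `c` is a union of open cells of `c'`). -/
def IsSubdivisionCW (c' c : CWComplex (univ : Set A)) : Prop :=
  ∀ (k : ℕ) (i : CWCell c' k), ∃ (l : ℕ) (j : CWCell c l), cwOpenCell c' k i ⊆ cwOpenCell c l j

/-- Two points lie in the same open cell of `c`. -/
def SameOpenCell (c : CWComplex C) (x y : A) : Prop :=
  ∃ (k : ℕ) (i : CWCell c k), x ∈ cwOpenCell c k i ∧ y ∈ cwOpenCell c k i

/-- `g` restricts to a homeomorphism from `s` onto `t`. -/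
def RestrictsToHomeo {B : Type v} [TopologicalSpace B] (g : A → B) (s : Set A) (t : Set B) :
    Prop :=
  IsEmbedding (s.domRestrict g) ∧ g '' s = t

/-- On each open cell of `c`, `g` restricts to a homeomorphism onto an open cell of `c'`
(of the same dimension, so that a continuous such `g` is in particular cellular). -/
def IsHomeoOnOpenCells {B : Type v} [TopologicalSpace B] {C' : Set B}
    (c : CWComplex C) (c' : CWComplex C') (g : A → B) : Prop :=
  ∀ (k : ℕ) (i : CWCell c k), ∃ j : CWCell c' k,
    RestrictsToHomeo g (cwOpenCell c k i) (cwOpenCell c' k j)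

/-- The `N`-cell `i` of `c` is the image of a polyhedral tile: there are a CW structure `s` on the
closed `N`-disk, whose only `N`-cell is the interior of the disk and all of whose other cells lie in
the boundary sphere, such that two different closed cells that intersect do so in a single closed
cell of lower dimension, and a map `ψ` of the disk onto the closed cell `i` that restricts to a
homeomorphism from each open cell of `s` onto an open cell of `c`. -/
def IsTileCell (c : CWComplex (univ : Set A)) (N : ℕ) (i : CWCell c N) : Prop :=
  ∃ (s : CWComplex (closedBall (0 : Fin N → ℝ) 1)) (ψ : (Fin N → ℝ) → A),
    (∃ top : CWCell s N, cwOpenCell s N top = ball 0 1 ∧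
      ∀ (k : ℕ) (e : CWCell s k), (⟨k, e⟩ : Σ k, CWCell s k) ≠ ⟨N, top⟩ →
        cwClosedCell s k e ⊆ sphere 0 1) ∧
    (∀ (k l : ℕ) (e : CWCell s k) (e' : CWCell s l),
      (⟨k, e⟩ : Σ k, CWCell s k) ≠ ⟨l, e'⟩ →
      (cwClosedCell s k e ∩ cwClosedCell s l e').Nonempty →
      ∃ (m : ℕ) (d : CWCell s m), m < max k l ∧
        cwClosedCell s m d = cwClosedCell s k e ∩ cwClosedCell s l e') ∧
    ContinuousOn ψ (closedBall 0 1) ∧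
    ψ '' closedBall 0 1 = cwClosedCell c N i ∧
    ψ '' ball 0 1 = cwOpenCell c N i ∧
    IsHomeoOnOpenCells s c ψ

end CW

/-! ### Subdivision rules and `R`-complexes -/

/-- A (colored) finite subdivision rule of dimension `N` whose subdivision complex has underlying
space `S`. -/
structure SubdivisionRule (N : ℕ) (S : Type u) [TopologicalSpace S] [T2Space S] where
  /-- the cell structure of the subdivision complex `S_R` -/
  cw : CWComplex (univ : Set S)
  cw_finite : IsFiniteCW cw
  cw_pure : IsPureCW cw N
  isTileCell : ∀ i : CWCell cw N, IsTileCell cw N i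
  /-- the cell structure of the subdivision `R(S_R)` -/
  sub : CWComplex (univ : Set S)
  sub_finite : IsFiniteCW sub
  sub_pure : IsPureCW sub N
  sub_isSubdivision : IsSubdivisionCW sub cw
  /-- the ideal tiles; the other tiles are the non-ideal ones -/
  ideal : Set (CWCell cw N)
  /-- the subdivision map `R(S_R) → S_R` -/
  subMap : S → S
  subMap_continuous : Continuous subMap
  subMap_homeo : IsHomeoOnOpenCells sub cw subMap
  subMap_ideal : MapsTo subMap (⋃ i ∈ ideal, cwClosedCell cw N i)
    (⋃ i ∈ ideal, cwClosedCell cw N i)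

/-- An `R`-complex with underlying space `X`. -/
structure RComplex {N : ℕ} {S : Type u} [TopologicalSpace S] [T2Space S]
    (R : SubdivisionRule N S) (X : Type v) [TopologicalSpace X] [T2Space X] where
  /-- the cell structure of `X` -/
  cw : CWComplex (univ : Set X)
  cw_pure : IsPureCW cw N
  /-- the structure map `X → S_R` -/
  toBase : X → S
  toBase_continuous : Continuous toBase
  toBase_homeo : IsHomeoOnOpenCells cw R.cw toBase

namespace RComplex

variable {N : ℕ} {S : Type u} [TopologicalSpace S] [T2Space S] {R : SubdivisionRule N S}
  {X : Type v} [TopologicalSpace X] [T2Space X] (K : RComplex R X)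

/-- The structure map `φ_R^n ∘ f : R^n(X) → S_R`. -/
def levelMap (n : ℕ) : X → S := fun x => R.subMap^[n] (K.toBase x)

/-- The open cell of `R^n(X)` that contains `x`. The cell structure of `R^(n+1)(X) = R(R^n(X))` is
the pullback of the cell structure of `R(S_R)` to the cells of `R^n(X)` along the structure map:
two points lie in the same open cell of `R^(n+1)(X)` if they lie in the same open cell of `R^n(X)`
and their images in `S_R` lie in the same open cell of `R(S_R)`. -/
def cellAt : ℕ → X → Set X
  | 0, x => {y | SameOpenCell K.cw x y}
  | n + 1, x => {y | y ∈ cellAt n x ∧ SameOpenCell R.sub (K.levelMap n x) (K.levelMap n y)}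

/-- `e` is an open cell of `R^n(X)`. -/
def IsLevelCell (n : ℕ) (e : Set X) : Prop := ∃ x, e = K.cellAt n x

/-- `e` is an open tile (an open `N`-cell) of `R^n(X)` whose tile type belongs to `T`. -/
def IsLevelTile (n : ℕ) (T : Set (CWCell R.cw N)) (e : Set X) : Prop :=
  ∃ x, ∃ i ∈ T, K.levelMap n x ∈ cwOpenCell R.cw N i ∧ e = K.cellAt n x

/-- The union of the (closed) ideal tiles of `R^n(X)`. -/
def idealUnion (n : ℕ) : Set X := ⋃ e ∈ {e | K.IsLevelTile n R.ideal e}, closure e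

/-- `Λ_n`, the union of the (closed) non-ideal tiles of `R^n(X)`. -/
def limitLevel (n : ℕ) : Set X := ⋃ e ∈ {e | K.IsLevelTile n R.idealᶜ e}, closure e

/-- The ideal set `Ω`: the union over all levels of the interior of the union of the ideal tiles of
that level. -/
def idealSet : Set X := ⋃ n, interior (K.idealUnion n)

/-- The limit set `Λ`, the complement of the ideal set. -/
def limitSet : Set X := K.idealSetᶜ

/-! ### The graphs `Γ_n` and the history graph -/

/-- `e` is a cell of `Λ_n`, that is, a vertex of `Γ_n`. Cells are represented by the corresponding
open cells. -/
def IsLevelVertex (n : ℕ) (e : Set X) : Prop := K.IsLevelCell n e ∧ e ⊆ K.limitLevel n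

/-- The graph `Γ_n`: its vertices are the cells of `Λ_n`, and its edges are the inclusions of a cell
in a larger (closed) cell. For convenience it is a graph on all subsets of `X`, the subsets that are
not cells of `Λ_n` being isolated; this does not affect distances between vertices of `Γ_n`. -/
def levelGraph (n : ℕ) : SimpleGraph (Set X) where
  Adj e e' := e ≠ e' ∧ K.IsLevelVertex n e ∧ K.IsLevelVertex n e' ∧
    (e ⊆ closure e' ∨ e' ⊆ closure e)
  symm := ⟨fun _ _ h => ⟨h.1.symm, h.2.2.1, h.2.1, h.2.2.2.symm⟩⟩
  loopless := ⟨fun _ h => h.1 rfl⟩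

/-- The path metric `d_n` of `Γ_n`, equal to `⊤` on vertices in different components. -/
def levelDist (n : ℕ) (e e' : Set X) : ℕ∞ := (K.levelGraph n).edist e e'

/-- The vertices of the history graph: the origin `none`, and the vertices of all the `Γ_n`. -/
abbrev HistoryVertex : Type v := Option (Σ n : ℕ, {e : Set X // K.IsLevelVertex n e})

/-- Adjacency in the history graph: the origin is joined to all vertices of `Γ_0`; the horizontal
edges are those of the `Γ_n`; the vertical edges join a cell of `Λ_n` to the cells of `Λ_(n+1)`
contained in it (as open cells). -/
def HistoryAdj : K.HistoryVertex → K.HistoryVertex → Prop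
  | none, none => False
  | none, some w => w.1 = 0
  | some v, none => v.1 = 0
  | some v, some w =>
      (v.1 = w.1 ∧ (K.levelGraph v.1).Adj v.2.1 w.2.1) ∨
      (w.1 = v.1 + 1 ∧ w.2.1 ⊆ v.2.1) ∨
      (v.1 = w.1 + 1 ∧ v.2.1 ⊆ w.2.1)

/-- The history graph `Γ = Γ(R, X)`. -/
def historyGraph : SimpleGraph K.HistoryVertex where
  Adj := K.HistoryAdj
  symm := ⟨by
    rintro (_ | ⟨a, v⟩) (_ | ⟨b, w⟩) h
    · exact h
    · exact h
    · exact h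
    · rcases h with ⟨h, h'⟩ | h | h
      · dsimp only at h h'
        subst h
        exact Or.inl ⟨rfl, h'.symm⟩
      · exact Or.inr (Or.inr h)
      · exact Or.inr (Or.inl h)⟩
  loopless := ⟨by
    rintro (_ | v) h
    · exact h
    · rcases h with ⟨-, h⟩ | ⟨h, -⟩ | ⟨h, -⟩
      · exact h.ne rfl
      · omega
      · omega⟩

/-- The transition function to level `m`, sending a cell `e` of a level `n ≥ m` to the open cell of
`R^m(X)` that contains it. -/
def transition (m : ℕ) (e : Set X) : Set X := ⋃ x ∈ e, K.cellAt m x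

/-- `R` is hyperbolic with respect to `X`. -/
def IsHyperbolicWrt : Prop :=
  ∃ M j : ℕ, 0 < M ∧ 0 < j ∧ ∀ (n : ℕ) (e e' : Set X),
    K.IsLevelVertex (n + j) e → K.IsLevelVertex (n + j) e' →
    K.levelDist (n + j) e e' < ⊤ →
    (M : ℕ∞) ≤ K.levelDist n (K.transition n e) (K.transition n e') →
    K.levelDist n (K.transition n e) (K.transition n e') < K.levelDist (n + j) e e'

/-- The equivalence relation on `Λ` that defines the canonical quotient: `d_n(f_n(x), f_n(y))` is
bounded as `n → ∞`, where the projection `f_n` sends `x` to the minimal cell of `Λ_n` that contains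
it, that is, to the cell whose open cell contains `x`. -/
def limitSetoid : Setoid K.limitSet where
  r x y := ∃ B : ℕ, ∀ n, K.levelDist n (K.cellAt n x) (K.cellAt n y) ≤ B
  iseqv :=
    { refl := fun _ => ⟨0, fun _ => by simp [levelDist]⟩
      symm := by
        rintro x y ⟨B, hB⟩
        exact ⟨B, fun n => by
          rw [levelDist, SimpleGraph.edist_comm]
          exact hB n⟩
      trans := by
        rintro x y z ⟨B, hB⟩ ⟨B', hB'⟩
        exact ⟨B + B', fun n => by
          push_cast
          exact SimpleGraph.edist_triangle.trans (add_le_add (hB n) (hB' n))⟩ }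

/-- The canonical quotient of the limit set, with the quotient topology. -/
abbrev CanonicalQuotient : Type v := Quotient K.limitSetoid

/-- The fiber of the canonical quotient map over `ξ`. -/
def fiber (ξ : K.CanonicalQuotient) : Set K.limitSet :=
  {x | Quotient.mk K.limitSetoid x = ξ}

/-- The combinatorial diameter of a subset of `Λ` in `Λ_n`: the diameter with respect to `d_n` of
its image under `f_n`. -/
def combDiam (n : ℕ) (F : Set K.limitSet) : ℕ∞ :=
  ⨆ x ∈ F, ⨆ y ∈ F, K.levelDist n (K.cellAt n x) (K.cellAt n y)

end RComplex

/-! ### Hyperbolic graphs and the Gromov boundary -/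

section Gromov

variable {V : Type v} (G : SimpleGraph V)

/-- The Gromov product `(x, y)_p` for the path metric of a connected graph. -/
def gromovProduct (p x y : V) : ℝ := ((G.dist p x : ℝ) + G.dist p y - G.dist x y) / 2

/-- `δ`-hyperbolicity, in terms of the Gromov product of vertices, of a connected graph with its
path metric. -/
def IsDeltaHyperbolic (δ : ℝ) : Prop :=
  0 < δ ∧ ∀ x y z p : V,
    min (gromovProduct G p x y) (gromovProduct G p y z) - δ < gromovProduct G p x z

/-- A geodesic ray of the graph starting at the vertex `o`, parametrized by arclength and given by
the sequence of the vertices that it passes. -/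
structure GeodesicRay (o : V) where
  toFun : ℕ → V
  start : toFun 0 = o
  geodesic : ∀ i j : ℕ, i ≤ j → G.dist (toFun i) (toFun j) = j - i

/-- Two rays are equivalent if the Gromov product of their points tends to infinity. -/
def RayEquiv (o : V) (γ ν : GeodesicRay G o) : Prop :=
  Tendsto (fun t => gromovProduct G o (γ.toFun t) (ν.toFun t)) atTop atTop

/-- The Gromov boundary as a set: the rays modulo the relation `RayEquiv`, which is an equivalence
relation if the graph is hyperbolic. -/
def GromovBoundary (o : V) : Type v := Quot (RayEquiv G o)

/-- The set `U(γ, r)` of the boundary points that have a representative `ν` such that the Gromov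
product of `γ(t)` and `ν(t)` is at least `r` for all sufficiently large `t`. -/
def boundaryNhd (o : V) (γ : GeodesicRay G o) (r : ℝ) : Set (GromovBoundary G o) :=
  {ξ | ∃ ν : GeodesicRay G o, Quot.mk (RayEquiv G o) ν = ξ ∧
    ∀ᶠ t in atTop, r ≤ gromovProduct G o (γ.toFun t) (ν.toFun t)}

/-- The standard topology of the Gromov boundary, for which the sets `U(γ, r)` form neighborhood
bases: a set is open if with each of its points `[γ]` it contains some `U(γ, r)`. -/
instance (o : V) : TopologicalSpace (GromovBoundary G o) where
  IsOpen W := ∀ γ : GeodesicRay G o, Quot.mk (RayEquiv G o) γ ∈ W →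
    ∃ r : ℝ, boundaryNhd G o γ r ⊆ W
  isOpen_univ := fun _ _ => ⟨0, subset_univ _⟩
  isOpen_inter := by
    intro W W' hW hW' γ hγ
    obtain ⟨r, hr⟩ := hW γ hγ.1
    obtain ⟨r', hr'⟩ := hW' γ hγ.2
    refine ⟨max r r', fun ξ hξ => ?_⟩
    obtain ⟨ν, hν, h⟩ := hξ
    exact ⟨hr ⟨ν, hν, h.mono fun t ht => (le_max_left r r').trans ht⟩,
      hr' ⟨ν, hν, h.mono fun t ht => (le_max_right r r').trans ht⟩⟩
  isOpen_sUnion := by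
    intro 𝒲 h γ hγ
    obtain ⟨W, hW, hγW⟩ := hγ
    obtain ⟨r, hr⟩ := h W hW γ hγW
    exact ⟨r, hr.trans (subset_sUnion_of_mem hW)⟩

end Gromov

end

noncomputable section

/-! ### Open and closed cells of CW complexes -/

section CWLemmas

variable {A : Type u} [TopologicalSpace A] {C : Set A}

/-! Two facts connect `Γ` with the level metrics. The projections to coarser levels do not increase
`d_n`, so `d_n(f_n(x), f_n(y))` is monotone in `n`. And a path of `Γ` that stays at level `m` or
deeper projects to a path of `Γ_m`: a horizontal edge becomes an edge or a point, a vertical edge a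
point. Hence a path that is short compared with its depth bounds a level distance
(`exists_levelDist_le_of_dist`).

The heart is `lt_of_levelDist_const`. Suppose that two points are at distance at least `L` on level
`q` and at most `L` on level `q + 2L`. Their cells on levels `q + L` and `q + 2L` form a
quadrilateral in `Γ` with two vertical sides of length `L`, two horizontal sides of length at most
`L`, and diagonals of length at least `2L`. The four-point condition then forces `L < δ`. Applied to
an initial segment of a geodesic of `Γ_(n+2M)` whose length does not drop under projection, this
gives `isHyperbolicWrt`. Applied to the eventually constant distance of two equivalent points, it
bounds that distance by `δ` on every level. So a fiber is a decreasing intersection of compact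
connected combinatorial balls, hence connected (`isConnected_fiber`).

For the homeomorphism, a point of `Λ` is sent to the ray of the cells containing it. Equivalent rays
stay within `4δ`, so two points have equivalent rays exactly if they are identified in the canonical
quotient. The closed cells along any ray are nested and by compactness contain a common point, which
gives surjectivity. The induced bijection is continuous (`continuous_boundaryPoint`) and closed
(`isClosedMap_boundaryPoint`).

All this needs closed cells of `R^n(X)` to be unions of open cells, which is false in a general CW
complex. It follows from the polyhedral structure of the tiles: the parametrization of a tile of
`S_R` lifts to the closed tiles over it, and the property descends from the disk
(`IsCellular.cell_subset_closure`). No CW structure on `R^n(X)` is built; `IsCellular` records what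
is used, and it passes to pullback subdivisions (`IsCellular.subdivide`). -/

theorem exists_mem_cwOpenCell (c : CWComplex C) {x : A} (hx : x ∈ C) :
    ∃ (k : ℕ) (i : CWCell c k), x ∈ cwOpenCell c k i := by
  let := c
  rw [← CWComplex.iUnion_openCell_eq_complex (C := C)] at hx
  simp only [mem_iUnion] at hx
  exact hx

theorem cwOpenCell_subset (c : CWComplex C) (k : ℕ) (i : CWCell c k) : cwOpenCell c k i ⊆ C :=
  let := c; RelCWComplex.openCell_subset_complex k i

theorem cwOpenCell_nonempty (c : CWComplex C) (k : ℕ) (i : CWCell c k) :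
    (cwOpenCell c k i).Nonempty :=
  let := c; RelCWComplex.openCell_nonempty k i

theorem cwOpenCell_inj (c : CWComplex C) {x : A} {k l : ℕ} {i : CWCell c k} {j : CWCell c l}
    (hi : x ∈ cwOpenCell c k i) (hj : x ∈ cwOpenCell c l j) :
    (⟨k, i⟩ : Σ k, CWCell c k) = ⟨l, j⟩ := by
  let := c
  by_contra h
  exact (RelCWComplex.disjoint_openCell_of_ne h).le_bot ⟨hi, hj⟩

theorem isPreconnected_cwOpenCell (c : CWComplex C) (k : ℕ) (i : CWCell c k) :
    IsPreconnected (cwOpenCell c k i) := by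
  let := c
  exact (convex_ball _ _).isPreconnected.image _
    ((RelCWComplex.continuousOn k i).mono ball_subset_closedBall)

theorem isCompact_cwClosedCell (c : CWComplex C) (k : ℕ) (i : CWCell c k) :
    IsCompact (cwClosedCell c k i) :=
  let := c; RelCWComplex.isCompact_closedCell

theorem cwOpenCell_subset_cwClosedCell (c : CWComplex C) (k : ℕ) (i : CWCell c k) :
    cwOpenCell c k i ⊆ cwClosedCell c k i :=
  let := c; RelCWComplex.openCell_subset_closedCell k i

theorem closure_cwOpenCell [T2Space A] (c : CWComplex C) (k : ℕ) (i : CWCell c k) :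
    closure (cwOpenCell c k i) = cwClosedCell c k i :=
  let := c; RelCWComplex.closure_openCell_eq_closedCell

theorem mem_cwClosedCell_cases (c : CWComplex C) {k : ℕ} {i : CWCell c k} {x : A}
    (hx : x ∈ cwClosedCell c k i) :
    x ∈ cwOpenCell c k i ∨ ∃ l < k, ∃ j : CWCell c l, x ∈ cwOpenCell c l j := by
  let := c
  rw [cwClosedCell, ← RelCWComplex.cellFrontier_union_openCell_eq_closedCell] at hx
  rcases hx with hx | hx
  · obtain ⟨I, hI⟩ := CWComplex.cellFrontier_subset_finite_openCell (C := C) k i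
    have := hI hx
    simp only [mem_iUnion] at this
    obtain ⟨l, hl, j, -, h⟩ := this
    exact Or.inr ⟨l, hl, j, h⟩
  · exact Or.inl hx

theorem finite_cwCells {c : CWComplex C} (hc : IsFiniteCW c) : Finite (Σ k, CWCell c k) := by
  let := c
  have : RelCWComplex.Finite C := hc
  exact RelCWComplex.finite_cells_of_finite (C := C)

/-- If two different closed cells that intersect do so in a closed cell of lower dimension, then
every closed cell is a union of open cells. -/
theorem cwOpenCell_subset_of_inter (c : CWComplex C)
    (h : ∀ (k l : ℕ) (e : CWCell c k) (e' : CWCell c l),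
      (⟨k, e⟩ : Σ k, CWCell c k) ≠ ⟨l, e'⟩ →
      (cwClosedCell c k e ∩ cwClosedCell c l e').Nonempty →
      ∃ (m : ℕ) (d : CWCell c m), m < max k l ∧
        cwClosedCell c m d = cwClosedCell c k e ∩ cwClosedCell c l e')
    {k l : ℕ} {e : CWCell c k} {e' : CWCell c l} {x : A}
    (hx : x ∈ cwClosedCell c k e) (hx' : x ∈ cwOpenCell c l e') :
    cwOpenCell c l e' ⊆ cwClosedCell c k e := by
  by_cases hne : (⟨k, e⟩ : Σ k, CWCell c k) = ⟨l, e'⟩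
  · cases hne
    exact cwOpenCell_subset_cwClosedCell c k e
  · obtain ⟨m, d, -, hd⟩ := h k l e e' hne ⟨x, hx, cwOpenCell_subset_cwClosedCell c l e' hx'⟩
    -- The cell `d` lies in the closed cell `e'`, so it is `e'` itself or has smaller dimension. The
    -- latter is impossible, since `x` lies in the open cell `e'`.
    have hdl : (⟨m, d⟩ : Σ k, CWCell c k) = ⟨l, e'⟩ ∨ m < l := by
      obtain ⟨y, hy⟩ := cwOpenCell_nonempty c m d
      have hy' : y ∈ cwClosedCell c l e' :=
        (hd.subset (cwOpenCell_subset_cwClosedCell c m d hy)).2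
      rcases mem_cwClosedCell_cases c hy' with h1 | ⟨p, hp, j, h1⟩
      · exact Or.inl (cwOpenCell_inj c hy h1)
      · cases cwOpenCell_inj c hy h1
        exact Or.inr hp
    have hxd : x ∈ cwClosedCell c m d := hd ▸ ⟨hx, cwOpenCell_subset_cwClosedCell c l e' hx'⟩
    rcases hdl with hdl | hml
    · cases hdl
      exact (cwOpenCell_subset_cwClosedCell c _ _).trans (hd.subset.trans inter_subset_left)
    · exfalso
      rcases mem_cwClosedCell_cases c hxd with h1 | ⟨p, hp, j, h1⟩
      · cases cwOpenCell_inj c hx' h1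
        omega
      · cases cwOpenCell_inj c hx' h1
        omega

end CWLemmas

/-! ### The open cell through a point and its dimension -/

section Carrier

variable {A : Type u} [TopologicalSpace A]

/-- The open cell of `c` that contains `x`. -/
def cwCarrier (c : CWComplex (univ : Set A)) (x : A) : Set A := {y | SameOpenCell c x y}

/-- The dimension of the open cell of `c` that contains `x`. -/
def cwDim (c : CWComplex (univ : Set A)) (x : A) : ℕ :=
  (exists_mem_cwOpenCell c (mem_univ x)).choose

variable {c : CWComplex (univ : Set A)}

theorem cwDim_eq {x : A} {k : ℕ} {i : CWCell c k} (h : x ∈ cwOpenCell c k i) : cwDim c x = k := by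
  obtain ⟨j, hj⟩ := (exists_mem_cwOpenCell c (mem_univ x)).choose_spec
  exact congrArg Sigma.fst (cwOpenCell_inj c hj h)

theorem cwCarrier_eq {x : A} {k : ℕ} {i : CWCell c k} (h : x ∈ cwOpenCell c k i) :
    cwCarrier c x = cwOpenCell c k i := by
  ext y
  constructor
  · rintro ⟨l, j, hx, hy⟩
    cases cwOpenCell_inj c h hx
    exact hy
  · exact fun hy => ⟨k, i, h, hy⟩

theorem exists_mem_cwDim (c : CWComplex (univ : Set A)) (x : A) :
    ∃ i : CWCell c (cwDim c x), x ∈ cwOpenCell c (cwDim c x) i :=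
  (exists_mem_cwOpenCell c (mem_univ x)).choose_spec

theorem exists_mem_cwOpenCell_of_cwDim_eq {x : A} {k : ℕ} (h : cwDim c x = k) :
    ∃ i : CWCell c k, x ∈ cwOpenCell c k i := by
  subst h
  exact exists_mem_cwDim c x

theorem mem_cwCarrier_self (c : CWComplex (univ : Set A)) (x : A) : x ∈ cwCarrier c x :=
  let ⟨i, hi⟩ := exists_mem_cwDim c x
  ⟨_, i, hi, hi⟩

theorem cwCarrier_eq_of_mem {x y : A} (h : y ∈ cwCarrier c x) : cwCarrier c y = cwCarrier c x := by
  obtain ⟨k, i, hx, hy⟩ := h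
  rw [cwCarrier_eq hx, cwCarrier_eq hy]

theorem cwDim_eq_of_mem {x y : A} (h : y ∈ cwCarrier c x) : cwDim c y = cwDim c x := by
  obtain ⟨k, i, hx, hy⟩ := h
  rw [cwDim_eq hx, cwDim_eq hy]

theorem isPreconnected_cwCarrier (c : CWComplex (univ : Set A)) (x : A) :
    IsPreconnected (cwCarrier c x) := by
  obtain ⟨i, hi⟩ := exists_mem_cwDim c x
  rw [cwCarrier_eq hi]
  exact isPreconnected_cwOpenCell c _ i

theorem cwDim_lt_of_mem_closure [T2Space A] {x y : A} (hy : y ∈ closure (cwCarrier c x))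
    (hy' : y ∉ cwCarrier c x) : cwDim c y < cwDim c x := by
  obtain ⟨i, hi⟩ := exists_mem_cwDim c x
  rw [cwCarrier_eq hi, closure_cwOpenCell] at hy
  rw [cwCarrier_eq hi] at hy'
  obtain ⟨l, hl, j, hj⟩ := (mem_cwClosedCell_cases c hy).resolve_left hy'
  rwa [cwDim_eq hj]

theorem finite_range_cwCarrier (hc : IsFiniteCW c) : (range (cwCarrier c)).Finite := by
  have := finite_cwCells hc
  refine (finite_range fun p : Σ k, CWCell c k => cwOpenCell c p.1 p.2).subset ?_
  rintro _ ⟨x, rfl⟩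
  obtain ⟨i, hi⟩ := exists_mem_cwDim c x
  exact ⟨⟨_, i⟩, (cwCarrier_eq hi).symm⟩

theorem cwDim_le {N : ℕ} (hc : IsPureCW c N) (x : A) : cwDim c x ≤ N := by
  by_contra h
  obtain ⟨i, -⟩ := exists_mem_cwDim c x
  exact (hc.1 _ (not_le.1 h)).elim i

theorem dense_cwDim_eq [T2Space A] {N : ℕ} (hc : IsPureCW c N) : Dense {x | cwDim c x = N} := by
  intro x
  have hx : x ∈ ⋃ i : CWCell c N, cwClosedCell c N i := hc.2.superset (mem_univ x)
  obtain ⟨i, hi⟩ := mem_iUnion.1 hx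
  rw [← closure_cwOpenCell] at hi
  exact closure_mono (fun y hy => cwDim_eq hy) hi

theorem isCompact_of_isFiniteCW (hc : IsFiniteCW c) : CompactSpace A := by
  have := finite_cwCells hc
  refine ⟨?_⟩
  have : (univ : Set A) = ⋃ p : Σ k, CWCell c k, cwClosedCell c p.1 p.2 := by
    refine (eq_univ_of_forall fun x => ?_).symm
    obtain ⟨i, hi⟩ := exists_mem_cwDim c x
    exact mem_iUnion.2 ⟨⟨_, i⟩, cwOpenCell_subset_cwClosedCell c _ i hi⟩
  rw [this]
  exact isCompact_iUnion fun p => isCompact_cwClosedCell c p.1 p.2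

end Carrier

/-- `cell` is a finite partition of `Y` into cells, each of which `h` maps homeomorphically onto an
open cell of `c`; the closure of a cell adds only points of lower dimension, and the points of
dimension `N` are dense. -/
structure IsCellular {S : Type u} [TopologicalSpace S] (c : CWComplex (univ : Set S)) (N : ℕ)
    {Y : Type v} [TopologicalSpace Y] (h : Y → S) (cell : Y → Set Y) : Prop where
  continuous : Continuous h
  mem_self : ∀ x, x ∈ cell x
  eq_of_mem : ∀ {x y}, y ∈ cell x → cell y = cell x
  finite : (range cell).Finite
  isEmbedding : ∀ x, IsEmbedding ((cell x).domRestrict h)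
  image_cell : ∀ x, h '' cell x = cwCarrier c (h x)
  dim_lt : ∀ {x y}, y ∈ closure (cell x) → y ∉ cell x → cwDim c (h y) < cwDim c (h x)
  dim_le : ∀ x, cwDim c (h x) ≤ N
  dense : Dense {x | cwDim c (h x) = N}

/-! ### Cellular partitions and their subdivisions -/

section Cellular

variable {S : Type u} [TopologicalSpace S] {c : CWComplex (univ : Set S)} {N : ℕ}

theorem IsHomeoOnOpenCells.cwDim_eq {Y : Type v} [TopologicalSpace Y]
    {c' : CWComplex (univ : Set Y)} {h : Y → S} (hh : IsHomeoOnOpenCells c' c h) (x : Y) :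
    cwDim c (h x) = cwDim c' x := by
  obtain ⟨i, hi⟩ := exists_mem_cwDim c' x
  obtain ⟨j, -, hj⟩ := hh _ i
  exact _root_.cwDim_eq (hj ▸ mem_image_of_mem h hi)

theorem IsHomeoOnOpenCells.isCellular {Y : Type v} [TopologicalSpace Y] [T2Space Y]
    {c' : CWComplex (univ : Set Y)} {h : Y → S} (hh : IsHomeoOnOpenCells c' c h)
    (hcont : Continuous h) (hfin : IsFiniteCW c') (hpure : IsPureCW c' N) :
    IsCellular c N h (cwCarrier c') where
  continuous := hcont
  mem_self := mem_cwCarrier_self c'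
  eq_of_mem := cwCarrier_eq_of_mem
  finite := finite_range_cwCarrier hfin
  isEmbedding x := by
    obtain ⟨i, hi⟩ := exists_mem_cwDim c' x
    obtain ⟨j, hj, -⟩ := hh _ i
    rw [cwCarrier_eq hi]
    exact hj
  image_cell x := by
    obtain ⟨i, hi⟩ := exists_mem_cwDim c' x
    obtain ⟨j, -, hj⟩ := hh _ i
    rw [cwCarrier_eq hi, hj, cwCarrier_eq (hj ▸ mem_image_of_mem h hi)]
  dim_lt hy hy' := by
    rw [hh.cwDim_eq, hh.cwDim_eq]
    exact cwDim_lt_of_mem_closure hy hy'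
  dim_le x := by
    rw [hh.cwDim_eq]
    exact cwDim_le hpure x
  dense := by
    simp only [hh.cwDim_eq]
    exact dense_cwDim_eq hpure

namespace IsCellular

variable {Y : Type v} [TopologicalSpace Y] {h : Y → S} {cell : Y → Set Y}

theorem injOn (H : IsCellular c N h cell) (x : Y) : InjOn h (cell x) :=
  injOn_iff_injective.2 (H.isEmbedding x).injective

theorem isPreconnected_cell (H : IsCellular c N h cell) (x : Y) : IsPreconnected (cell x) := by
  have h1 : IsPreconnected (range ((cell x).domRestrict h)) := by
    rw [range_domRestrict, H.image_cell]
    exact isPreconnected_cwCarrier c _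
  have h2 : IsPreconnected (univ : Set (cell x)) := by
    rw [← (H.isEmbedding x).isInducing.isPreconnected_image, image_univ]
    exact h1
  simpa using h2.image _ continuous_subtype_val.continuousOn

theorem dim_eq (H : IsCellular c N h cell) {x y : Y} (hy : y ∈ cell x) :
    cwDim c (h y) = cwDim c (h x) :=
  cwDim_eq_of_mem (H.image_cell x ▸ mem_image_of_mem h hy)

/-- A cell of maximal dimension meets the closure of no other cell, so its complement is a finite
union of closures. -/
theorem isOpen_cell (H : IsCellular c N h cell) {x : Y} (hx : cwDim c (h x) = N) :
    IsOpen (cell x) := by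
  have : (cell x)ᶜ = ⋃ e ∈ {e ∈ range cell | e ≠ cell x}, closure e := by
    ext y
    simp only [mem_compl_iff, mem_iUnion, mem_ofPred_eq, exists_prop]
    constructor
    · intro hy
      exact ⟨cell y, ⟨⟨y, rfl⟩, fun e => hy (e ▸ H.mem_self y)⟩, subset_closure (H.mem_self y)⟩
    · rintro ⟨_, ⟨⟨z, rfl⟩, hz⟩, hy⟩ hy'
      by_cases hyz : y ∈ cell z
      · exact hz ((H.eq_of_mem hyz).symm.trans (H.eq_of_mem hy'))
      · have := H.dim_lt hy hyz
        rw [H.dim_eq hy', hx] at this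
        exact absurd (H.dim_le z) (not_le.2 this)
  rw [← isClosed_compl_iff, this]
  exact (H.finite.subset (sep_subset _ _)).isClosed_biUnion fun _ _ => isClosed_closure

/-- Every point lies in the closure of an `N`-cell. -/
theorem exists_mem_closure (H : IsCellular c N h cell) (y : Y) :
    ∃ x, cwDim c (h x) = N ∧ y ∈ closure (cell x) := by
  have h1 : {x | cwDim c (h x) = N} ⊆ ⋃ e ∈ cell '' {x | cwDim c (h x) = N}, closure e :=
    fun x hx => mem_biUnion (mem_image_of_mem cell hx) (subset_closure (H.mem_self x))
  have h2 : IsClosed (⋃ e ∈ cell '' {x | cwDim c (h x) = N}, closure e) :=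
    (H.finite.subset (image_subset_range _ _)).isClosed_biUnion fun _ _ => isClosed_closure
  have h3 := h2.closure_subset_iff.2 h1 (H.dense y)
  simp only [mem_iUnion, exists_prop] at h3
  obtain ⟨_, ⟨x, hx, rfl⟩, hy⟩ := h3
  exact ⟨x, hx, hy⟩

/-- The pullback of a subdivision along a cellular map. -/
theorem subdivide (H : IsCellular c N h cell) {φ : S → S} {sub : S → Set S}
    (Hφ : IsCellular c N φ sub) (hsub : ∀ s, sub s ⊆ cwCarrier c s)
    (hopen : ∀ s, cwDim c s = N → IsOpen (cwCarrier c s)) :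
    IsCellular c N (φ ∘ h) (fun x => cell x ∩ h ⁻¹' sub (h x)) where
  continuous := Hφ.continuous.comp H.continuous
  mem_self x := ⟨H.mem_self x, Hφ.mem_self _⟩
  eq_of_mem {x y} hy := by
    simp only [H.eq_of_mem hy.1, Hφ.eq_of_mem hy.2]
  finite := by
    refine (H.finite.image2 (fun e a => e ∩ h ⁻¹' a) Hφ.finite).subset ?_
    rintro _ ⟨x, rfl⟩
    exact ⟨_, ⟨x, rfl⟩, _, ⟨h x, rfl⟩, rfl⟩
  isEmbedding x := by
    have h1 : IsEmbedding ((cell x ∩ h ⁻¹' sub (h x)).domRestrict h) :=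
      (H.isEmbedding x).comp (IsEmbedding.inclusion inter_subset_left)
    exact (Hφ.isEmbedding (h x)).comp (h1.codRestrict (sub (h x)) fun y => y.2.2)
  image_cell x := by
    rw [image_comp, image_inter_preimage, H.image_cell, inter_eq_right.2 (hsub _), Hφ.image_cell]
    rfl
  dim_lt {x y} hy hy' := by
    -- If the image stays in the same cell of the subdivision, then `y` has left the coarse cell,
    -- and the coarse dimension would drop although the coarse open cell below is the same. So the
    -- image leaves its cell, and the dimension drops downstairs.
    by_cases hyx : h y ∈ sub (h x)
    · have h1 := H.dim_lt (closure_mono inter_subset_left hy) fun h2 => hy' ⟨h2, hyx⟩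
      rw [cwDim_eq_of_mem (hsub _ hyx)] at h1
      exact absurd h1 (lt_irrefl _)
    · refine Hφ.dim_lt ?_ hyx
      exact closure_mono (image_subset_iff.2 inter_subset_right)
        (image_closure_subset_closure_image H.continuous (mem_image_of_mem h hy))
  dim_le x := Hφ.dim_le _
  dense := by
    rw [dense_iff_inter_open]
    rintro U hU hne
    obtain ⟨z, hzU, hz⟩ := H.dense.inter_open_nonempty U hU hne
    obtain ⟨V, hV, hVU⟩ := (H.isEmbedding z).isInducing.isOpen_iff.1
      (hU.preimage continuous_subtype_val)
    have hmem : ∀ w (hw : w ∈ cell z), h w ∈ V ↔ w ∈ U := fun w hw =>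
      Set.ext_iff.1 hVU ⟨w, hw⟩
    -- Inside a top-dimensional cell, which is open downstairs, density is transported along the
    -- homeomorphism with the open cell below.
    obtain ⟨s, ⟨hsV, hsC⟩, hs⟩ := Hφ.dense.inter_open_nonempty _ (hV.inter (hopen _ hz))
      ⟨h z, (hmem z (H.mem_self z)).2 hzU, mem_cwCarrier_self c _⟩
    rw [← H.image_cell] at hsC
    obtain ⟨w, hw, rfl⟩ := hsC
    exact ⟨w, (hmem w hw).1 hsV, hs⟩

end IsCellular

end Cellular

/-- The intersection of a decreasing sequence of compact preconnected sets is preconnected. -/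
theorem isPreconnected_iInter_of_antitone {X : Type*} [TopologicalSpace X] [T2Space X]
    {A : ℕ → Set X} (hA : Antitone A) (hc : ∀ n, IsCompact (A n))
    (hp : ∀ n, IsPreconnected (A n)) : IsPreconnected (⋂ n, A n) := by
  have hcl : IsClosed (⋂ n, A n) := isClosed_iInter fun n => (hc n).isClosed
  rw [isPreconnected_iff_subset_of_fully_disjoint_closed hcl]
  intro u v hu hv huv hd
  have hK : IsCompact (⋂ n, A n) := (hc 0).of_isClosed_subset hcl (iInter_subset _ 0)
  obtain ⟨U, V, hU, hV, hKU, hKV, hUV⟩ := SeparatedNhds.of_isCompact_isCompact (hK.inter_right hu)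
    (hK.inter_right hv) (hd.mono inter_subset_right inter_subset_right)
  have hsub : (⋂ n, A n) ⊆ U ∪ V := fun x hx =>
    (huv hx).imp (fun h => hKU ⟨hx, h⟩) (fun h => hKV ⟨hx, h⟩)
  obtain ⟨n, hn⟩ : ∃ n, A n ⊆ U ∪ V := by
    by_contra! h
    -- By compactness some `A n` already lies in `U ∪ V`; otherwise the sets `A n \ (U ∪ V)` would
    -- have a common point.
    have hne := IsCompact.nonempty_iInter_of_sequence_nonempty_isCompact_isClosed
      (fun n => A n \ (U ∪ V)) (fun n => sdiff_subset_sdiff_left (hA n.le_succ))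
      (fun n => not_subset.1 (h n)) ((hc 0).diff (hU.union hV))
      (fun n => ((hc n).diff (hU.union hV)).isClosed)
    obtain ⟨x, hx⟩ := hne
    rw [mem_iInter] at hx
    exact (hx 0).2 (hsub (mem_iInter.2 fun n => (hx n).1))
  rcases (hp n).subset_or_subset hU hV hUV hn with h | h
  · refine Or.inl fun x hx => (huv hx).resolve_right fun hxv => ?_
    exact hUV.le_bot ⟨h (mem_iInter.1 hx n), hKV ⟨hx, hxv⟩⟩
  · refine Or.inr fun x hx => (huv hx).resolve_left fun hxu => ?_
    exact hUV.le_bot ⟨hKU ⟨hx, hxu⟩, h (mem_iInter.1 hx n)⟩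

/-! ### Lifting of tiles, and closed cells as unions of cells -/

namespace IsCellular

variable {S : Type u} [TopologicalSpace S] [T2Space S] {c : CWComplex (univ : Set S)} {N : ℕ}
  {Y : Type v} [TopologicalSpace Y] [T2Space Y] [CompactSpace Y] {h : Y → S} {cell : Y → Set Y}

omit [T2Space S] [T2Space Y] [CompactSpace Y] in
theorem finite_fiber (H : IsCellular c N h cell) (s : S) : (h ⁻¹' {s}).Finite := by
  have : h ⁻¹' {s} = ⋃ e ∈ range cell, e ∩ h ⁻¹' {s} := by
    ext x
    simp only [mem_iUnion, mem_inter_iff, exists_prop]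
    exact ⟨fun hx => ⟨cell x, ⟨x, rfl⟩, H.mem_self x, hx⟩, fun ⟨_, _, _, hx⟩ => hx⟩
  rw [this]
  refine H.finite.biUnion ?_
  rintro _ ⟨x, rfl⟩
  refine Set.Subsingleton.finite fun y hy z hz => H.injOn x hy.1 hz.1 ?_
  exact hy.2.trans hz.2.symm

/-- A map of a ball whose composition with `h` extends continuously to the closed ball has limits
at the points of the closed ball, since the cluster set is connected and finite. -/
theorem exists_tendsto_of_comp (H : IsCellular c N h cell) {E : Type*} [NormedAddCommGroup E]
    [NormedSpace ℝ E] {g : E → Y} {ψ : E → S} (hψ : ContinuousOn ψ (closedBall 0 1))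
    (hg : ContinuousOn g (ball 0 1)) (hgψ : ∀ p ∈ ball (0 : E) 1, h (g p) = ψ p) {p : E}
    (hp : p ∈ closedBall (0 : E) 1) : ∃ y, Tendsto g (𝓝[ball 0 1] p) (𝓝 y) := by
  set F : Filter Y := map g (𝓝[ball 0 1] p) with hF
  have hp' : p ∈ closure (ball (0 : E) 1) := by rwa [closure_ball _ one_ne_zero]
  have : (𝓝[ball 0 1] p).NeBot := mem_closure_iff_nhdsWithin_neBot.1 hp'
  -- The intersection of these sets is the cluster set of `g` at `p`; convexity of the
  -- half-neighborhoods makes each of them connected.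
  let A : ℕ → Set Y := fun n => closure (g '' (ball 0 1 ∩ ball p (1 / ((n : ℝ) + 1))))
  have hA : Antitone A := fun m n hmn => closure_mono <| image_mono <|
    inter_subset_inter_right _ <| ball_subset_ball <| Nat.one_div_le_one_div hmn
  have hApre : IsPreconnected (⋂ n, A n) := by
    refine isPreconnected_iInter_of_antitone hA (fun n => isClosed_closure.isCompact) fun n => ?_
    exact (((convex_ball _ _).inter (convex_ball _ _)).isPreconnected.image _
      (hg.mono inter_subset_left)).closure
  have hclA : ∀ y, ClusterPt y F → y ∈ ⋂ n, A n := fun y hy => mem_iInter.2 fun n => by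
    refine clusterPt_iff_forall_mem_closure.1 hy _ (image_mem_map ?_)
    exact inter_mem_nhdsWithin _ (ball_mem_nhds p (by positivity))
  have hAh : (⋂ n, A n) ⊆ h ⁻¹' {ψ p} := by
    intro y hy
    have hcl : ClusterPt y F := by
      refine clusterPt_iff_forall_mem_closure.2 fun s hs => ?_
      obtain ⟨ε, hε, hεs⟩ := Metric.mem_nhdsWithin_iff.1 hs
      obtain ⟨n, hn⟩ := exists_nat_one_div_lt hε
      refine closure_mono ?_ (mem_iInter.1 hy n)
      refine image_subset_iff.2 fun q hq => hεs ⟨ball_subset_ball hn.le hq.2, hq.1⟩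
    have h1 : ClusterPt (h y) (map h F) := hcl.map H.continuous.continuousAt tendsto_map
    have h2 : map h F ≤ 𝓝 (ψ p) := by
      have : Tendsto ψ (𝓝[ball 0 1] p) (𝓝 (ψ p)) := (hψ p hp).mono ball_subset_closedBall
      rw [hF, map_map]
      refine this.congr' ?_
      filter_upwards [self_mem_nhdsWithin] with q hq using (hgψ q hq).symm
    by_contra hne
    have h3 : Disjoint (𝓝 (h y)) (𝓝 (ψ p)) := disjoint_nhds_nhds.2 hne
    exact h1.neBot.ne (h3.mono_right h2).eq_bot
  have hsub : (⋂ n, A n).Subsingleton := by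
    by_contra hns
    exact hApre.infinite_of_nontrivial (not_subsingleton_iff.1 hns) ((H.finite_fiber _).subset hAh)
  obtain ⟨y, hy⟩ := exists_clusterPt_of_compactSpace F
  exact ⟨y, le_nhds_of_unique_clusterPt fun z hz => hsub (hclA z hz) (hclA y hy)⟩

/-- A parametrization of a top-dimensional cell of `c` lifts to the cells over it. -/
theorem exists_lift (H : IsCellular c N h cell) {E : Type*} [NormedAddCommGroup E]
    [NormedSpace ℝ E] [ProperSpace E] {ψ : E → S} (hψ : ContinuousOn ψ (closedBall 0 1)) {x : Y}
    (hx : ψ '' ball 0 1 = cwCarrier c (h x)) :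
    ∃ g : E → Y, ContinuousOn g (closedBall 0 1) ∧ (∀ p ∈ closedBall (0 : E) 1, h (g p) = ψ p) ∧
      g '' closedBall 0 1 = closure (cell x) := by
  have hex : ∀ p ∈ ball (0 : E) 1, ∃ y : cell x, h y = ψ p := fun p hp => by
    have : ψ p ∈ h '' cell x := by
      rw [H.image_cell, ← hx]
      exact mem_image_of_mem _ hp
    obtain ⟨y, hy, e⟩ := this
    exact ⟨⟨y, hy⟩, e⟩
  have : Nonempty (cell x) := ⟨⟨x, H.mem_self x⟩⟩
  -- On the open ball the lift is `ψ` followed by the inverse of the homeomorphism `h` on the cell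
  -- of `x`.
  choose! g₀ hg₀ using hex
  have hg₀c : ContinuousOn (fun p => (g₀ p : Y)) (ball 0 1) := by
    refine continuous_subtype_val.comp_continuousOn ?_
    rw [(H.isEmbedding x).isInducing.continuousOn_iff]
    exact (hψ.mono ball_subset_closedBall).congr fun p hp => hg₀ p hp
  have hlim := fun p (hp : p ∈ closedBall (0 : E) 1) =>
    H.exists_tendsto_of_comp hψ hg₀c (fun p hp => hg₀ p hp) hp
  have hcl : closedBall (0 : E) 1 = closure (ball 0 1) := (closure_ball _ one_ne_zero).symm
  let g := extendFrom (ball 0 1) fun p => (g₀ p : Y)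
  have hgc : ContinuousOn g (closedBall 0 1) := continuousOn_extendFrom hcl.subset hlim
  have hgg : ∀ p ∈ ball (0 : E) 1, g p = g₀ p := extendFrom_extends hg₀c
  have hgball : g '' ball 0 1 = cell x := by
    ext y
    constructor
    · rintro ⟨p, hp, rfl⟩
      rw [hgg p hp]
      exact (g₀ p).2
    · intro hy
      have : h y ∈ ψ '' ball 0 1 := by
        rw [hx, ← H.image_cell]
        exact mem_image_of_mem h hy
      obtain ⟨p, hp, e⟩ := this
      exact ⟨p, hp, H.injOn x (by rw [hgg p hp]; exact (g₀ p).2) hy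
        (by rw [hgg p hp, hg₀ p hp, e])⟩
  refine ⟨g, hgc, ?_, ?_⟩
  · have h1 : EqOn (h ∘ g) ψ (ball 0 1) := fun p hp => by
      simp only [Function.comp_apply, hgg p hp, hg₀ p hp]
    exact h1.of_subset_closure (H.continuous.comp_continuousOn hgc) hψ ball_subset_closedBall
      hcl.subset
  · apply subset_antisymm
    · rw [hcl, ← hgball]
      exact (hcl ▸ hgc).image_closure
    · refine closure_minimal ?_ ((isCompact_closedBall 0 1).image_of_continuousOn hgc).isClosed
      rw [← hgball]
      exact image_mono ball_subset_closedBall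

omit [T2Space S] [T2Space Y] [CompactSpace Y] in
/-- A connected set lying over an open cell lies in a single cell. -/
theorem subset_cell_of_isPreconnected (H : IsCellular c N h cell) {T : Set Y}
    (hT : IsPreconnected T) {x : Y} (hx : x ∈ T) (hTx : ∀ y ∈ T, h y ∈ cwCarrier c (h x)) :
    T ⊆ cell x := by
  have hcl : ∀ y z, z ∈ T → cwDim c (h y) = cwDim c (h x) → z ∈ closure (cell y) → z ∈ cell y := by
    intro y z hz hy hzy
    by_contra hn
    have := H.dim_lt hzy hn
    rw [hy, cwDim_eq_of_mem (hTx z hz)] at this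
    exact lt_irrefl _ this
  -- The closure of the cell of `x` and the closures of the other cells met by `T` cover `T`. Over
  -- one open cell no drop of dimension is possible, so the two closed sets are disjoint on `T`.
  let Q := cell '' {y | y ∈ T ∧ y ∉ cell x}
  have hQ : IsClosed (⋃ e ∈ Q, closure e) :=
    (H.finite.subset (image_subset_range _ _)).isClosed_biUnion fun _ _ => isClosed_closure
  have hcov : T ⊆ closure (cell x) ∪ ⋃ e ∈ Q, closure e := by
    intro y hy
    by_cases hyx : y ∈ cell x
    · exact Or.inl (subset_closure hyx)
    · exact Or.inr (mem_biUnion (mem_image_of_mem cell ⟨hy, hyx⟩) (subset_closure (H.mem_self y)))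
  have hdis : T ∩ (closure (cell x) ∩ ⋃ e ∈ Q, closure e) = ∅ := by
    rw [eq_empty_iff_forall_notMem]
    rintro z ⟨hz, hzx, hzQ⟩
    simp only [mem_iUnion, exists_prop] at hzQ
    obtain ⟨_, ⟨y, ⟨hy, hyx⟩, rfl⟩, hzy⟩ := hzQ
    have h1 := H.eq_of_mem (hcl x z hz rfl hzx)
    have h2 := H.eq_of_mem (hcl y z hz (cwDim_eq_of_mem (hTx y hy)) hzy)
    exact hyx (h1 ▸ h2 ▸ H.mem_self y)
  have hsub : T ⊆ closure (cell x) := by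
    rcases isPreconnected_iff_subset_of_disjoint_closed.1 hT _ _ isClosed_closure hQ hcov hdis
      with h1 | h1
    · exact h1
    · exact absurd (eq_empty_iff_forall_notMem.1 hdis x)
        (not_not.2 ⟨hx, subset_closure (H.mem_self x), h1 hx⟩)
  exact fun z hz => hcl x z hz rfl (hsub hz)

/-- If the top-dimensional cells of `c` are polyhedral tiles, then a cell that meets the closure of
another cell lies in this closure. -/
theorem cell_subset_closure (H : IsCellular c N h cell) (htile : ∀ i : CWCell c N, IsTileCell c N i)
    {x y : Y} (hy : y ∈ closure (cell x)) : cell y ⊆ closure (cell x) := by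
  obtain ⟨z, hz, hxz⟩ := H.exists_mem_closure x
  obtain ⟨i, hi⟩ := exists_mem_cwOpenCell_of_cwDim_eq hz
  obtain ⟨s, ψ, -, hs, hψ, -, hψb, hψo⟩ := htile i
  obtain ⟨g, hg, hgψ, hgx⟩ := H.exists_lift hψ (hψb.trans (cwCarrier_eq hi).symm)
  -- The lift takes each open cell of the disk onto a whole cell: the image is connected over one
  -- open cell, so it lies in a single cell, and injectivity of `h` there makes it everything.
  have hcell : ∀ (k : ℕ) (e : CWCell s k), ∀ p ∈ cwOpenCell s k e,
      g '' cwOpenCell s k e = cell (g p) := by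
    intro k e p hp
    have hsubs := cwOpenCell_subset s k e
    obtain ⟨j, -, hj⟩ := hψo k e
    have hgp := hgψ p (hsubs hp)
    have hcar : cwCarrier c (h (g p)) = ψ '' cwOpenCell s k e := by
      rw [hj, cwCarrier_eq]
      rw [← hj, hgp]
      exact mem_image_of_mem ψ hp
    have h1 : g '' cwOpenCell s k e ⊆ cell (g p) := by
      refine H.subset_cell_of_isPreconnected
        ((isPreconnected_cwOpenCell s k e).image _ (hg.mono hsubs)) (mem_image_of_mem g hp) ?_
      rintro _ ⟨q, hq, rfl⟩
      rw [hcar, hgψ q (hsubs hq)]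
      exact mem_image_of_mem ψ hq
    refine h1.antisymm fun w hw => ?_
    have : h w ∈ ψ '' cwOpenCell s k e := by
      rw [← hcar, ← H.image_cell]
      exact mem_image_of_mem h hw
    obtain ⟨q, hq, e'⟩ := this
    refine ⟨q, hq, H.injOn _ (h1 (mem_image_of_mem g hq)) hw ?_⟩
    rw [hgψ q (hsubs hq), e']
  rw [← hgx] at hxz
  obtain ⟨p, hp, rfl⟩ := hxz
  obtain ⟨k, e, hpe⟩ := exists_mem_cwOpenCell s hp
  have hclosed : closure (cell (g p)) = g '' cwClosedCell s k e := by
    have hsub : cwClosedCell s k e ⊆ closedBall 0 1 := by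
      rw [← closure_cwOpenCell]
      exact closure_minimal (cwOpenCell_subset s k e) isClosed_closedBall
    rw [← hcell k e p hpe]
    apply subset_antisymm
    · exact closure_minimal (image_mono (cwOpenCell_subset_cwClosedCell s k e))
        ((isCompact_cwClosedCell s k e).image_of_continuousOn (hg.mono hsub)).isClosed
    · rw [← closure_cwOpenCell] at hsub ⊢
      exact (hg.mono hsub).image_closure
  rw [hclosed] at hy ⊢
  obtain ⟨q, hq, rfl⟩ := hy
  have hqD : q ∈ closedBall (0 : Fin N → ℝ) 1 := by
    rw [← closure_cwOpenCell] at hq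
    exact closure_minimal (cwOpenCell_subset s k e) isClosed_closedBall hq
  obtain ⟨l, e', hqe⟩ := exists_mem_cwOpenCell s hqD
  rw [← hcell l e' q hqe]
  exact image_mono (cwOpenCell_subset_of_inter s hs hq hqe)

end IsCellular

/-! ### The cells of the subdivisions and the sets `Λ_n` -/

namespace RComplex

variable {N : ℕ} {S : Type u} [TopologicalSpace S] [T2Space S] {R : SubdivisionRule N S}
  {X : Type v} [TopologicalSpace X] [T2Space X] (K : RComplex R X)

theorem isOpen_cwCarrier_of_cwDim_eq (R : SubdivisionRule N S) {s : S} (hs : cwDim R.cw s = N) :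
    IsOpen (cwCarrier R.cw s) := by
  have hid : IsHomeoOnOpenCells R.cw R.cw id := fun k i =>
    ⟨i, IsEmbedding.subtypeVal, image_id _⟩
  exact (hid.isCellular continuous_id R.cw_finite R.cw_pure).isOpen_cell hs

theorem sub_isCellular (R : SubdivisionRule N S) :
    IsCellular R.cw N R.subMap (cwCarrier R.sub) :=
  R.subMap_homeo.isCellular R.subMap_continuous R.sub_finite R.sub_pure

theorem cwCarrier_sub_subset (R : SubdivisionRule N S) (s : S) :
    cwCarrier R.sub s ⊆ cwCarrier R.cw s := by
  obtain ⟨i, hi⟩ := exists_mem_cwDim R.sub s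
  obtain ⟨l, j, hj⟩ := R.sub_isSubdivision _ i
  rw [cwCarrier_eq hi, cwCarrier_eq (hj hi)]
  exact hj

theorem levelMap_succ (n : ℕ) : K.levelMap (n + 1) = R.subMap ∘ K.levelMap n :=
  funext fun x => Function.iterate_succ_apply' R.subMap n (K.toBase x)

/-- The cells of `R^n(X)` form a cellular partition. -/
theorem isCellular_cellAt (hK : IsFiniteCW K.cw) (n : ℕ) :
    IsCellular R.cw N (K.levelMap n) (K.cellAt n) := by
  induction n with
  | zero => exact K.toBase_homeo.isCellular K.toBase_continuous hK K.cw_pure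
  | succ n ih =>
    rw [levelMap_succ]
    exact ih.subdivide (sub_isCellular R) (cwCarrier_sub_subset R)
      fun s hs => isOpen_cwCarrier_of_cwDim_eq R hs

/-- A point is in the closed cell `e` of `R^n(X)` only if the cell containing it is. -/
theorem cellAt_subset_closure (hK : IsFiniteCW K.cw) {n : ℕ} {x y : X}
    (hy : y ∈ closure (K.cellAt n x)) : K.cellAt n y ⊆ closure (K.cellAt n x) := by
  have : CompactSpace X := isCompact_of_isFiniteCW hK
  exact (K.isCellular_cellAt hK n).cell_subset_closure R.isTileCell hy

theorem cellAt_antitone (x : X) : Antitone fun n => K.cellAt n x :=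
  antitone_nat_of_succ_le fun _ _ hy => hy.1

variable {K}

theorem mem_limitLevel_iff {n : ℕ} {x : X} : x ∈ K.limitLevel n ↔
    ∃ z, ∃ i, i ∉ R.ideal ∧ K.levelMap n z ∈ cwOpenCell R.cw N i ∧ x ∈ closure (K.cellAt n z) := by
  simp only [limitLevel, IsLevelTile, mem_iUnion, mem_ofPred_eq, exists_prop, mem_compl_iff]
  constructor
  · rintro ⟨_, ⟨z, i, hi, hz, rfl⟩, hx⟩
    exact ⟨z, i, hi, hz, hx⟩
  · rintro ⟨z, i, hi, hz, hx⟩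
    exact ⟨_, ⟨z, i, hi, hz, rfl⟩, hx⟩

theorem mem_idealUnion_iff {n : ℕ} {x : X} : x ∈ K.idealUnion n ↔
    ∃ z, ∃ i, i ∈ R.ideal ∧ K.levelMap n z ∈ cwOpenCell R.cw N i ∧ x ∈ closure (K.cellAt n z) := by
  simp only [idealUnion, IsLevelTile, mem_iUnion, mem_ofPred_eq, exists_prop]
  constructor
  · rintro ⟨_, ⟨z, i, hi, hz, rfl⟩, hx⟩
    exact ⟨z, i, hi, hz, hx⟩
  · rintro ⟨z, i, hi, hz, hx⟩
    exact ⟨_, ⟨z, i, hi, hz, rfl⟩, hx⟩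

theorem isClosed_limitLevel (hK : IsFiniteCW K.cw) (n : ℕ) : IsClosed (K.limitLevel n) := by
  refine ((K.isCellular_cellAt hK n).finite.subset ?_).isClosed_biUnion fun _ _ => isClosed_closure
  rintro _ ⟨x, _, _, _, rfl⟩
  exact ⟨x, rfl⟩

theorem cellAt_subset_limitLevel (hK : IsFiniteCW K.cw) {n : ℕ} {x : X}
    (hx : x ∈ K.limitLevel n) : K.cellAt n x ⊆ K.limitLevel n := by
  obtain ⟨z, i, hi, hz, hxz⟩ := mem_limitLevel_iff.1 hx
  exact fun y hy => mem_limitLevel_iff.2 ⟨z, i, hi, hz, K.cellAt_subset_closure hK hxz hy⟩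

theorem limitLevel_union_idealUnion (hK : IsFiniteCW K.cw) (n : ℕ) (x : X) :
    x ∈ K.limitLevel n ∨ x ∈ K.idealUnion n := by
  obtain ⟨z, hz, hx⟩ := (K.isCellular_cellAt hK n).exists_mem_closure x
  obtain ⟨i, hi⟩ := exists_mem_cwOpenCell_of_cwDim_eq hz
  by_cases h : i ∈ R.ideal
  · exact Or.inr (mem_idealUnion_iff.2 ⟨z, i, h, hi, hx⟩)
  · exact Or.inl (mem_limitLevel_iff.2 ⟨z, i, h, hi, hx⟩)

/-- Each level contains the next one, as tiles inside ideal tiles are ideal. -/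
theorem limitLevel_succ_subset (hK : IsFiniteCW K.cw) (n : ℕ) :
    K.limitLevel (n + 1) ⊆ K.limitLevel n := by
  intro x hx
  obtain ⟨z, i, hi, hz, hxz⟩ := mem_limitLevel_iff.1 hx
  have H := K.isCellular_cellAt hK
  have hsub : K.cellAt (n + 1) z ⊆ K.cellAt n z := K.cellAt_antitone z n.le_succ
  have hopen := (H (n + 1)).isOpen_cell (cwDim_eq hz)
  -- A tile of level `n + 1` is open, so it meets a tile of level `n` and therefore lies in it.
  obtain ⟨w, hw, hwN⟩ := (H n).dense.inter_open_nonempty _ hopen ⟨z, (H (n + 1)).mem_self z⟩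
  have hzN : cwDim R.cw (K.levelMap n z) = N := by
    rw [← (H n).dim_eq (hsub hw)]
    exact hwN
  obtain ⟨j, hj⟩ := exists_mem_cwOpenCell_of_cwDim_eq hzN
  refine mem_limitLevel_iff.2 ⟨z, j, fun hjI => ?_, hj, closure_mono hsub hxz⟩
  have h1 := R.subMap_ideal (mem_biUnion hjI (cwOpenCell_subset_cwClosedCell R.cw N j hj))
  rw [levelMap_succ] at hz
  simp only [mem_iUnion, exists_prop] at h1
  obtain ⟨l, hl, hmem⟩ := h1
  rcases mem_cwClosedCell_cases R.cw hmem with h2 | ⟨p, hp, q, h2⟩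
  · cases cwOpenCell_inj R.cw h2 hz
    exact hi hl
  · cases cwOpenCell_inj R.cw h2 hz
    exact lt_irrefl _ hp

theorem limitLevel_antitone (hK : IsFiniteCW K.cw) : Antitone K.limitLevel :=
  antitone_nat_of_succ_le (limitLevel_succ_subset hK)

/-- Open tiles are open sets, so an open non-ideal tile meets no closed ideal tile; hence `Λ_n` is
the closure of the complement of the ideal union. -/
theorem compl_interior_idealUnion (hK : IsFiniteCW K.cw) (n : ℕ) :
    (interior (K.idealUnion n))ᶜ = K.limitLevel n := by
  have H := K.isCellular_cellAt hK n
  rw [← closure_compl]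
  apply subset_antisymm
  · exact closure_minimal (fun x hx => (limitLevel_union_idealUnion hK n x).resolve_right hx)
      (isClosed_limitLevel hK n)
  · intro x hx
    obtain ⟨z, i, hi, hz, hxz⟩ := mem_limitLevel_iff.1 hx
    refine closure_mono (fun y hy hyI => ?_) hxz
    obtain ⟨w, j, hj, hw, hyw⟩ := mem_idealUnion_iff.1 hyI
    obtain ⟨a, ha, haw⟩ := mem_closure_iff.1 hyw _ (H.isOpen_cell (cwDim_eq hz)) hy
    have h1 : K.levelMap n w ∈ cwOpenCell R.cw N i := by
      rw [← cwCarrier_eq hz, ← H.image_cell, ← H.eq_of_mem ha, H.eq_of_mem haw]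
      exact mem_image_of_mem _ (H.mem_self w)
    cases cwOpenCell_inj R.cw h1 hw
    exact hi hj

theorem mem_limitSet_iff (hK : IsFiniteCW K.cw) {x : X} :
    x ∈ K.limitSet ↔ ∀ n, x ∈ K.limitLevel n := by
  simp only [limitSet, idealSet, compl_iUnion, compl_interior_idealUnion hK, mem_iInter]

theorem isClosed_limitSet : IsClosed K.limitSet :=
  (isOpen_iUnion fun _ => isOpen_interior).isClosed_compl

/-! ### The graphs of the levels -/

theorem isLevelVertex_cellAt (hK : IsFiniteCW K.cw) {n : ℕ} {x : X} (hx : x ∈ K.limitLevel n) :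
    K.IsLevelVertex n (K.cellAt n x) :=
  ⟨⟨x, rfl⟩, cellAt_subset_limitLevel hK hx⟩

theorem IsLevelVertex.exists_eq_cellAt (hK : IsFiniteCW K.cw) {n : ℕ} {e : Set X}
    (he : K.IsLevelVertex n e) : ∃ x ∈ K.limitLevel n, e = K.cellAt n x := by
  obtain ⟨⟨x, rfl⟩, h⟩ := he
  exact ⟨x, h ((K.isCellular_cellAt hK n).mem_self x), rfl⟩

theorem transition_cellAt (hK : IsFiniteCW K.cw) {m n : ℕ} (hmn : m ≤ n) (x : X) :
    K.transition m (K.cellAt n x) = K.cellAt m x := by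
  have H := K.isCellular_cellAt hK
  apply subset_antisymm
  · refine iUnion₂_subset fun y hy => ?_
    rw [(H m).eq_of_mem (K.cellAt_antitone x hmn hy)]
  · exact subset_biUnion_of_mem (u := fun y => K.cellAt m y) ((H n).mem_self x)

theorem levelDist_cellAt_le_one (hK : IsFiniteCW K.cw) {n : ℕ} {x y : X}
    (hx : x ∈ K.limitLevel n) (hy : y ∈ closure (K.cellAt n x)) :
    K.levelDist n (K.cellAt n x) (K.cellAt n y) ≤ 1 := by
  rw [levelDist, SimpleGraph.edist_le_one_iff_adj_or_eq]
  by_cases h : K.cellAt n x = K.cellAt n y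
  · exact Or.inr h
  · have hy' : y ∈ K.limitLevel n :=
      closure_minimal (cellAt_subset_limitLevel hK hx) (isClosed_limitLevel hK n) hy
    exact Or.inl ⟨h, isLevelVertex_cellAt hK hx, isLevelVertex_cellAt hK hy',
      Or.inr (K.cellAt_subset_closure hK hy)⟩

/-- Passing to a coarser level enlarges the cells, so a point of one cell in the closure of the
other remains so. The two coarse cells may coincide. -/
theorem levelDist_transition_le_one (hK : IsFiniteCW K.cw) {m n : ℕ} (hmn : m ≤ n) {e e' : Set X}
    (h : (K.levelGraph n).Adj e e') :
    K.levelDist m (K.transition m e) (K.transition m e') ≤ 1 := by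
  have key : ∀ {e e' : Set X}, K.IsLevelVertex n e → K.IsLevelVertex n e' → e ⊆ closure e' →
      K.levelDist m (K.transition m e') (K.transition m e) ≤ 1 := by
    intro e e' he he' hsub
    obtain ⟨x, hx, rfl⟩ := he.exists_eq_cellAt hK
    obtain ⟨y, hy, rfl⟩ := he'.exists_eq_cellAt hK
    rw [transition_cellAt hK hmn, transition_cellAt hK hmn]
    exact levelDist_cellAt_le_one hK (limitLevel_antitone hK hmn hy)
      (closure_mono (K.cellAt_antitone y hmn) (hsub ((K.isCellular_cellAt hK n).mem_self x)))
  obtain ⟨-, he, he', h | h⟩ := h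
  · rw [levelDist, SimpleGraph.edist_comm]
    exact key he he' h
  · exact key he' he h

theorem levelDist_transition_le_length (hK : IsFiniteCW K.cw) {m n : ℕ} (hmn : m ≤ n)
    {e e' : Set X} (w : (K.levelGraph n).Walk e e') :
    K.levelDist m (K.transition m e) (K.transition m e') ≤ w.length := by
  induction w with
  | nil => simp [levelDist]
  | cons h p ih =>
    rw [SimpleGraph.Walk.length_cons, Nat.cast_add, Nat.cast_one, add_comm]
    exact SimpleGraph.edist_triangle.trans
      (add_le_add (levelDist_transition_le_one hK hmn h) ih)

theorem levelDist_transition_le (hK : IsFiniteCW K.cw) {m n : ℕ} (hmn : m ≤ n) (e e' : Set X) :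
    K.levelDist m (K.transition m e) (K.transition m e') ≤ K.levelDist n e e' := by
  by_cases h : K.levelDist n e e' = ⊤
  · rw [h]
    exact le_top
  · obtain ⟨w, hw⟩ := SimpleGraph.exists_walk_of_edist_ne_top h
    rw [levelDist, levelDist, ← hw]
    exact levelDist_transition_le_length hK hmn w

theorem levelDist_cellAt_mono (hK : IsFiniteCW K.cw) (x y : X) :
    Monotone fun n => K.levelDist n (K.cellAt n x) (K.cellAt n y) := by
  intro m n hmn
  have := levelDist_transition_le hK hmn (K.cellAt n x) (K.cellAt n y)
  rwa [transition_cellAt hK hmn, transition_cellAt hK hmn] at this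

theorem isLevelVertex_of_walk {n : ℕ} {e e' : Set X} (he : K.IsLevelVertex n e)
    (w : (K.levelGraph n).Walk e e') : K.IsLevelVertex n e' := by
  induction w with
  | nil => exact he
  | cons h p ih => exact ih h.2.2.1

/-! ### Combinatorial balls -/

variable (K)

/-- The union of the closed cells of `Λ_n` at distance at most `B` from the cell of `x`. -/
def levelBall (n : ℕ) (x : X) (B : ℕ) : Set X :=
  ⋃ e ∈ {e | K.IsLevelVertex n e ∧ K.levelDist n (K.cellAt n x) e ≤ B}, closure e

variable {K}

theorem mem_levelBall (hK : IsFiniteCW K.cw) {n : ℕ} {x y : X} {B : ℕ} (hy : y ∈ K.limitLevel n)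
    (h : K.levelDist n (K.cellAt n x) (K.cellAt n y) ≤ B) : y ∈ K.levelBall n x B :=
  mem_biUnion (x := K.cellAt n y) ⟨isLevelVertex_cellAt hK hy, h⟩
    (subset_closure ((K.isCellular_cellAt hK n).mem_self y))

theorem exists_of_mem_levelBall (hK : IsFiniteCW K.cw) {n : ℕ} {x y : X} {B : ℕ}
    (h : y ∈ K.levelBall n x B) : ∃ z ∈ K.limitLevel n, y ∈ closure (K.cellAt n z) ∧
      K.levelDist n (K.cellAt n x) (K.cellAt n z) ≤ B := by
  simp only [levelBall, mem_iUnion, mem_ofPred_eq, exists_prop] at h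
  obtain ⟨e, ⟨he, hd⟩, hy⟩ := h
  obtain ⟨z, hz, rfl⟩ := he.exists_eq_cellAt hK
  exact ⟨z, hz, hy, hd⟩

theorem mem_limitLevel_of_mem_levelBall (hK : IsFiniteCW K.cw) {n : ℕ} {x y : X} {B : ℕ}
    (h : y ∈ K.levelBall n x B) : y ∈ K.limitLevel n := by
  obtain ⟨z, hz, hyz, -⟩ := exists_of_mem_levelBall hK h
  exact closure_minimal (cellAt_subset_limitLevel hK hz) (isClosed_limitLevel hK n) hyz

theorem levelDist_le_of_mem_levelBall (hK : IsFiniteCW K.cw) {n : ℕ} {x y : X} {B : ℕ}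
    (h : y ∈ K.levelBall n x B) : K.levelDist n (K.cellAt n x) (K.cellAt n y) ≤ (B + 1 : ℕ) := by
  obtain ⟨z, hz, hyz, hd⟩ := exists_of_mem_levelBall hK h
  rw [Nat.cast_add, Nat.cast_one]
  exact SimpleGraph.edist_triangle.trans (add_le_add hd (levelDist_cellAt_le_one hK hz hyz))

theorem isClosed_levelBall (hK : IsFiniteCW K.cw) (n : ℕ) (x : X) (B : ℕ) :
    IsClosed (K.levelBall n x B) := by
  refine ((K.isCellular_cellAt hK n).finite.subset ?_).isClosed_biUnion fun _ _ => isClosed_closure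
  rintro _ ⟨⟨⟨y, rfl⟩, -⟩, -⟩
  exact ⟨y, rfl⟩

theorem levelBall_antitone (hK : IsFiniteCW K.cw) (x : X) (B : ℕ) :
    Antitone fun n => K.levelBall n x B := by
  intro m n hmn y hy
  obtain ⟨z, hz, hyz, hd⟩ := exists_of_mem_levelBall hK hy
  exact mem_biUnion (x := K.cellAt m z)
    ⟨isLevelVertex_cellAt hK (limitLevel_antitone hK hmn hz),
      (levelDist_cellAt_mono hK x z hmn).trans hd⟩
    (closure_mono (K.cellAt_antitone z hmn) hyz)

/-- Cells are connected, and the closures of adjacent cells intersect. -/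
theorem isPreconnected_iUnion_support (hK : IsFiniteCW K.cw) {n : ℕ} {e e' : Set X}
    (he : K.IsLevelVertex n e) (w : (K.levelGraph n).Walk e e') :
    IsPreconnected (⋃ f ∈ {f | f ∈ w.support}, closure f) := by
  have hpre : ∀ {f : Set X}, K.IsLevelVertex n f → IsPreconnected (closure f) := by
    rintro _ ⟨⟨y, rfl⟩, -⟩
    exact ((K.isCellular_cellAt hK n).isPreconnected_cell y).closure
  have hne : ∀ {f : Set X}, K.IsLevelVertex n f → f.Nonempty := by
    rintro _ ⟨⟨y, rfl⟩, -⟩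
    exact ⟨y, (K.isCellular_cellAt hK n).mem_self y⟩
  induction w with
  | nil => simpa using hpre he
  | @cons e f e' h p ih =>
    have hu : (⋃ g ∈ {g | g ∈ (SimpleGraph.Walk.cons h p).support}, closure g) =
        closure e ∪ ⋃ g ∈ {g | g ∈ p.support}, closure g := by
      ext y
      simp [SimpleGraph.Walk.support_cons]
    rw [hu]
    have hf : closure f ⊆ ⋃ g ∈ {g | g ∈ p.support}, closure g :=
      subset_biUnion_of_mem (u := fun g => closure g) (show f ∈ p.support from p.start_mem_support)
    obtain ⟨-, -, hfv, hef⟩ := h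
    obtain ⟨y, hye, hyf⟩ : (closure e ∩ closure f).Nonempty := by
      rcases hef with hef | hef
      · obtain ⟨y, hy⟩ := hne he
        exact ⟨y, subset_closure hy, hef hy⟩
      · obtain ⟨y, hy⟩ := hne hfv
        exact ⟨y, hef hy, subset_closure hy⟩
    exact (hpre he).union y hye (hf hyf) (ih hfv)

theorem isPreconnected_levelBall (hK : IsFiniteCW K.cw) {n : ℕ} {x : X} (hx : x ∈ K.limitLevel n)
    (B : ℕ) : IsPreconnected (K.levelBall n x B) := by
  refine isPreconnected_of_forall x fun y hy => ?_
  simp only [levelBall, mem_iUnion, mem_ofPred_eq, exists_prop] at hy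
  obtain ⟨e, ⟨he, hd⟩, hye⟩ := hy
  have hx' := isLevelVertex_cellAt hK hx
  obtain ⟨w, hw⟩ := SimpleGraph.exists_walk_of_edist_ne_top
    (ne_top_of_le_ne_top (ENat.natCast_ne_top B) hd)
  refine ⟨_, ?_, ?_, ?_, isPreconnected_iUnion_support hK hx' w⟩
  -- A shortest walk from the center to a cell of the ball does not leave the ball.
  · refine iUnion₂_subset fun f hf => ?_
    refine subset_biUnion_of_mem (u := fun g => closure g)
      ⟨isLevelVertex_of_walk hx' (w.takeUntil f hf), ?_⟩
    refine (SimpleGraph.edist_le (w.takeUntil f hf)).trans (le_trans ?_ (hw.le.trans hd))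
    exact_mod_cast w.length_takeUntil_le_length hf
  · exact mem_biUnion (x := K.cellAt n x) w.start_mem_support
      (subset_closure ((K.isCellular_cellAt hK n).mem_self x))
  · exact mem_biUnion (x := e) w.end_mem_support hye

end RComplex

namespace RComplex

variable {N : ℕ} {S : Type u} [TopologicalSpace S] [T2Space S] {R : SubdivisionRule N S}
  {X : Type v} [TopologicalSpace X] [T2Space X] {K : RComplex R X}

/-! ### Distances in the history graph -/

/-- The distance of a vertex of the history graph to the origin. -/
def height : K.HistoryVertex → ℕ
  | none => 0
  | some v => v.1 + 1

/-- The projection of the vertices of the history graph to `Γ_m`. -/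
def proj (m : ℕ) : K.HistoryVertex → Set X
  | none => ∅
  | some v => K.transition m v.2.1

theorem height_le_of_adj {u v : K.HistoryVertex} (h : K.historyGraph.Adj u v) :
    height v ≤ height u + 1 := by
  rcases u with _ | u <;> rcases v with _ | v
  · exact Nat.zero_le _
  · exact Nat.le_of_eq (congrArg (· + 1) (show v.1 = 0 from h))
  · exact Nat.zero_le _
  · simp only [height]
    rcases h with h | h | h
    · omega
    · omega
    · omega

theorem height_le_of_walk {u v : K.HistoryVertex} (w : K.historyGraph.Walk u v) :
    height v ≤ height u + w.length := by
  induction w with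
  | nil => simp
  | cons h p ih =>
    have := height_le_of_adj h
    rw [SimpleGraph.Walk.length_cons]
    omega

theorem cellAt_eq_of_subset (hK : IsFiniteCW K.cw) {m n : ℕ} {x y : X}
    (h : K.cellAt n y ⊆ K.cellAt m x) : K.cellAt m y = K.cellAt m x :=
  (K.isCellular_cellAt hK m).eq_of_mem (h ((K.isCellular_cellAt hK n).mem_self y))

theorem transition_eq_of_subset (hK : IsFiniteCW K.cw) {l m n : ℕ} (hlm : l ≤ m) (hmn : m ≤ n)
    {e e' : Set X} (he : K.IsLevelVertex m e) (he' : K.IsLevelVertex n e') (h : e' ⊆ e) :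
    K.transition l e = K.transition l e' := by
  obtain ⟨x, -, rfl⟩ := he.exists_eq_cellAt hK
  obtain ⟨y, -, rfl⟩ := he'.exists_eq_cellAt hK
  rw [← cellAt_eq_of_subset hK h, transition_cellAt hK hlm, transition_cellAt hK (hlm.trans hmn)]

/-- An edge is either horizontal or vertical, so it cannot change both the projection and the
height. The two inequalities say that `D` plus the height difference is at most 1. -/
theorem exists_levelDist_proj_of_adj (hK : IsFiniteCW K.cw) {u v : K.HistoryVertex} {m : ℕ}
    (h : K.historyGraph.Adj u v) (hu : m + 1 ≤ height u) (hv : m + 1 ≤ height v) :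
    ∃ D : ℕ, K.levelDist m (proj m u) (proj m v) ≤ D ∧ D + height u ≤ 1 + height v ∧
      D + height v ≤ 1 + height u := by
  rcases u with _ | ⟨a, e, he⟩
  · simp [height] at hu
  rcases v with _ | ⟨b, f, hf⟩
  · simp [height] at hv
  simp only [height] at hu hv ⊢
  simp only [proj]
  rcases h with ⟨h, h'⟩ | ⟨h, h'⟩ | ⟨h, h'⟩ <;> dsimp only at h h'
  · subst h
    exact ⟨1, levelDist_transition_le_one hK (by omega) h', by omega, by omega⟩
  · refine ⟨0, ?_, by omega, by omega⟩
    rw [transition_eq_of_subset hK (by omega) (by omega) he hf h', levelDist,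
      SimpleGraph.edist_self]
    exact le_rfl
  · refine ⟨0, ?_, by omega, by omega⟩
    rw [transition_eq_of_subset hK (by omega) (by omega) hf he h', levelDist,
      SimpleGraph.edist_self]
    exact le_rfl

/-- A path that stays below level `m` has at least as many edges as the distance of the projections
of its endpoints to level `m` plus the difference of their heights. -/
theorem exists_levelDist_proj_of_walk (hK : IsFiniteCW K.cw) {m : ℕ} {u v : K.HistoryVertex}
    (w : K.historyGraph.Walk u v) (hw : m + 1 + w.length ≤ height u) :
    ∃ D : ℕ, K.levelDist m (proj m u) (proj m v) ≤ D ∧ D + height u ≤ w.length + height v ∧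
      D + height v ≤ w.length + height u := by
  induction w with
  | nil => exact ⟨0, by simp [levelDist], by simp, by simp⟩
  | @cons u v x h p ih =>
    rw [SimpleGraph.Walk.length_cons] at hw ⊢
    have h1 := height_le_of_adj h
    have h2 := height_le_of_adj h.symm
    -- One step lowers the height by at most 1 and the remaining length by exactly 1, so the depth
    -- condition passes to the tail.
    obtain ⟨D, hD, hD1, hD2⟩ := ih (by omega)
    obtain ⟨D', hD', hD1', hD2'⟩ := exists_levelDist_proj_of_adj hK (m := m) h (by omega) (by omega)
    refine ⟨D' + D, ?_, by omega, by omega⟩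
    rw [Nat.cast_add]
    exact SimpleGraph.edist_triangle.trans (add_le_add hD' hD)

/-- The vertex of the history graph given by the cell of `Λ_n` that contains `x`. -/
def vertexAt (hK : IsFiniteCW K.cw) (n : ℕ) {x : X} (hx : x ∈ K.limitLevel n) : K.HistoryVertex :=
  some ⟨n, K.cellAt n x, isLevelVertex_cellAt hK hx⟩

theorem historyGraph_adj_vertexAt_succ (hK : IsFiniteCW K.cw) {n : ℕ} {x : X}
    (hx : x ∈ K.limitLevel n) (hx' : x ∈ K.limitLevel (n + 1)) :
    K.historyGraph.Adj (vertexAt hK n hx) (vertexAt hK (n + 1) hx') :=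
  Or.inr (Or.inl ⟨rfl, K.cellAt_antitone x n.le_succ⟩)

theorem exists_walk_vertexAt (hK : IsFiniteCW K.cw) {m n : ℕ} (hmn : m ≤ n) {x : X}
    (hx : x ∈ K.limitLevel m) (hx' : x ∈ K.limitLevel n) :
    ∃ w : K.historyGraph.Walk (vertexAt hK m hx) (vertexAt hK n hx'), w.length = n - m := by
  induction n, hmn using Nat.le_induction with
  | base => exact ⟨.nil, by simp⟩
  | succ n hmn ih =>
    obtain ⟨w, hw⟩ := ih (limitLevel_succ_subset hK n hx')
    refine ⟨w.concat (historyGraph_adj_vertexAt_succ hK _ hx'), ?_⟩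
    rw [SimpleGraph.Walk.length_concat, hw]
    omega

theorem exists_walk_origin (hK : IsFiniteCW K.cw) {n : ℕ} {x : X} (hx : x ∈ K.limitLevel n) :
    ∃ w : K.historyGraph.Walk none (vertexAt hK n hx), w.length = n + 1 := by
  have h0 := limitLevel_antitone hK n.zero_le hx
  obtain ⟨w, hw⟩ := exists_walk_vertexAt hK n.zero_le h0 hx
  have hadj : K.historyGraph.Adj none (vertexAt hK 0 h0) := show (0 : ℕ) = 0 from rfl
  exact ⟨.cons hadj w, by rw [SimpleGraph.Walk.length_cons, hw, Nat.sub_zero]⟩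

theorem exists_eq_vertexAt (hK : IsFiniteCW K.cw) (v : Σ n : ℕ, {e : Set X // K.IsLevelVertex n e}) :
    ∃ (x : X) (hx : x ∈ K.limitLevel v.1), some v = vertexAt hK v.1 hx := by
  obtain ⟨n, e, he⟩ := v
  obtain ⟨x, hx, rfl⟩ := he.exists_eq_cellAt hK
  exact ⟨x, hx, rfl⟩

theorem historyGraph_connected (hK : IsFiniteCW K.cw) : K.historyGraph.Connected := by
  refine (SimpleGraph.connected_iff_exists_forall_reachable _).2 ⟨none, ?_⟩
  rintro (_ | v)
  · exact SimpleGraph.Reachable.refl _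
  · obtain ⟨x, hx, e⟩ := exists_eq_vertexAt hK v
    rw [e]
    exact (exists_walk_origin hK hx).choose.reachable

/-- Heights change by at most 1 along an edge, and the cells containing a fixed point form a
vertical path that attains this bound. -/
theorem dist_origin (hK : IsFiniteCW K.cw) (v : K.HistoryVertex) :
    K.historyGraph.dist none v = height v := by
  apply le_antisymm
  · rcases v with _ | v
    · simp [height]
    · obtain ⟨x, hx, e⟩ := exists_eq_vertexAt hK v
      rw [e]
      obtain ⟨w, hw⟩ := exists_walk_origin hK hx
      exact (SimpleGraph.dist_le w).trans hw.le
  · obtain ⟨w, hw⟩ := (historyGraph_connected hK).exists_walk_length_eq_dist none v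
    rw [← hw]
    exact (height_le_of_walk w).trans (by simp [height])

theorem height_le_height_add_dist (hK : IsFiniteCW K.cw) (u v : K.HistoryVertex) :
    height v ≤ height u + K.historyGraph.dist u v := by
  obtain ⟨w, hw⟩ := (historyGraph_connected hK).exists_walk_length_eq_dist u v
  rw [← hw]
  exact height_le_of_walk w

theorem dist_vertexAt (hK : IsFiniteCW K.cw) {m n : ℕ} (hmn : m ≤ n) {x : X}
    (hx : x ∈ K.limitLevel m) (hx' : x ∈ K.limitLevel n) :
    K.historyGraph.dist (vertexAt hK m hx) (vertexAt hK n hx') = n - m := by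
  apply le_antisymm
  · obtain ⟨w, hw⟩ := exists_walk_vertexAt hK hmn hx hx'
    exact (SimpleGraph.dist_le w).trans hw.le
  · have := height_le_height_add_dist hK (vertexAt hK m hx) (vertexAt hK n hx')
    simp only [height, vertexAt] at this ⊢
    omega

theorem exists_walk_of_levelGraph_walk {n : ℕ} {e e' : Set X} (w : (K.levelGraph n).Walk e e')
    (he : K.IsLevelVertex n e) (he' : K.IsLevelVertex n e') :
    ∃ w' : K.historyGraph.Walk (some ⟨n, e, he⟩) (some ⟨n, e', he'⟩), w'.length = w.length := by
  induction w with
  | nil => exact ⟨.nil, rfl⟩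
  | cons h p ih =>
    obtain ⟨w', hw'⟩ := ih h.2.2.1 he'
    have hadj : K.historyGraph.Adj (some ⟨n, _, he⟩) (some ⟨n, _, h.2.2.1⟩) := Or.inl ⟨rfl, h⟩
    exact ⟨.cons hadj w', by
      rw [SimpleGraph.Walk.length_cons, SimpleGraph.Walk.length_cons, hw']⟩

theorem dist_le_of_levelDist_le (hK : IsFiniteCW K.cw) {n D : ℕ} {x y : X}
    (hx : x ∈ K.limitLevel n) (hy : y ∈ K.limitLevel n)
    (h : K.levelDist n (K.cellAt n x) (K.cellAt n y) ≤ D) :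
    K.historyGraph.dist (vertexAt hK n hx) (vertexAt hK n hy) ≤ D := by
  obtain ⟨w, hw⟩ := SimpleGraph.exists_walk_of_edist_ne_top
    (ne_top_of_le_ne_top (ENat.natCast_ne_top D) h)
  obtain ⟨w', hw'⟩ := exists_walk_of_levelGraph_walk w (isLevelVertex_cellAt hK hx)
    (isLevelVertex_cellAt hK hy)
  refine (SimpleGraph.dist_le w').trans ?_
  rw [hw']
  exact_mod_cast hw.le.trans h

/-- A geodesic from level `a` of length at most `a - m` does not rise above level `m`. When `a > b`,
its at least `a - b` vertical edges do not contribute to the projection. -/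
theorem exists_levelDist_le_of_dist (hK : IsFiniteCW K.cw) {m a b : ℕ} {x y : X} (hmb : m ≤ b)
    (hx : x ∈ K.limitLevel a) (hy : y ∈ K.limitLevel b)
    (h : m + K.historyGraph.dist (vertexAt hK a hx) (vertexAt hK b hy) ≤ a) :
    ∃ D : ℕ, K.levelDist m (K.cellAt m x) (K.cellAt m y) ≤ D ∧
      D + a ≤ K.historyGraph.dist (vertexAt hK a hx) (vertexAt hK b hy) + b := by
  obtain ⟨w, hw⟩ := (historyGraph_connected hK).exists_walk_length_eq_dist
    (vertexAt hK a hx) (vertexAt hK b hy)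
  rw [← hw] at h ⊢
  obtain ⟨D, hD, hD1, -⟩ := exists_levelDist_proj_of_walk hK (m := m) w (by
    simp only [height, vertexAt] at h ⊢
    omega)
  simp only [proj, height, vertexAt] at hD hD1
  rw [transition_cellAt hK (by omega), transition_cellAt hK hmb] at hD
  simp only [vertexAt]
  exact ⟨D, hD, by omega⟩

/-- The four-point condition bounds the distances that stay constant over many levels. -/
theorem lt_of_levelDist_const (hK : IsFiniteCW K.cw) {δ : ℝ}
    (hδ : IsDeltaHyperbolic K.historyGraph δ) {L q : ℕ} {x y : X}
    (hx : x ∈ K.limitLevel (q + 2 * L)) (hy : y ∈ K.limitLevel (q + 2 * L))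
    (h1 : K.levelDist (q + 2 * L) (K.cellAt (q + 2 * L) x) (K.cellAt (q + 2 * L) y) ≤ L)
    (h2 : (L : ℕ∞) ≤ K.levelDist q (K.cellAt q x) (K.cellAt q y)) : (L : ℝ) < δ := by
  have hle : q + L ≤ q + 2 * L := by omega
  have hx' := limitLevel_antitone hK hle hx
  have hy' := limitLevel_antitone hK hle hy
  have hxy := dist_le_of_levelDist_le hK hx hy h1
  have hxy' := dist_le_of_levelDist_le hK hx' hy' ((levelDist_cellAt_mono hK x y hle).trans h1)
  have hxx := dist_vertexAt hK hle hx' hx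
  have hyy := dist_vertexAt hK hle hy' hy
  have key : ∀ {x y : X} (hx : x ∈ K.limitLevel (q + 2 * L)) (hy' : y ∈ K.limitLevel (q + L)),
      (L : ℕ∞) ≤ K.levelDist q (K.cellAt q x) (K.cellAt q y) →
      2 * L ≤ K.historyGraph.dist (vertexAt hK _ hx) (vertexAt hK _ hy') := by
    intro x y hx hy' h2
    by_contra hlt
    -- A diagonal shorter than `2 * L` stays at level `q` or deeper and spends at least `L` edges
    -- vertically, leaving fewer than `L` for the projection to `Γ_q`.
    obtain ⟨D, hD, hD'⟩ := exists_levelDist_le_of_dist hK (m := q) (by omega) hx hy' (by omega)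
    have : L ≤ D := by exact_mod_cast h2.trans hD
    omega
  have k1 := key hx hy' h2
  have k2 := key hy hx' (by rwa [levelDist, SimpleGraph.edist_comm])
  -- With this order and base point, both Gromov products in the minimum exceed the remaining one by
  -- at least `L`.
  have hyp := hδ.2 (vertexAt hK _ hx) (vertexAt hK _ hy) (vertexAt hK _ hy') (vertexAt hK _ hx')
  simp only [gromovProduct] at hyp
  rw [SimpleGraph.dist_comm] at k2
  rw [SimpleGraph.dist_comm] at hyy
  rw [hxx, hyy] at hyp
  have e1 : q + 2 * L - (q + L) = L := by omega
  rw [e1] at hyp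
  rify at hxy hxy' k1 k2
  rcases min_lt_iff.1 (sub_lt_iff_lt_add.1 hyp) with h | h
  · linarith
  · linarith

theorem isHyperbolicWrt (hK : IsFiniteCW K.cw) {δ : ℝ}
    (hδ : IsDeltaHyperbolic K.historyGraph δ) : K.IsHyperbolicWrt := by
  obtain ⟨M, hM⟩ := exists_nat_gt δ
  have hM0 : 0 < M := by
    rify
    exact hδ.1.trans hM
  refine ⟨M, 2 * M, hM0, by omega, fun n e e' he he' hfin hMd => ?_⟩
  by_contra hcon
  rw [not_lt] at hcon
  have hn : n ≤ n + 2 * M := by omega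
  obtain ⟨w, hw⟩ := SimpleGraph.exists_walk_of_edist_ne_top hfin.ne
  have hle := levelDist_transition_le hK hn e e'
  have hMw : M ≤ w.length := by
    have := hMd.trans hle
    rw [levelDist, ← hw] at this
    exact_mod_cast this
  -- Projection does not shorten the geodesic `w`, so it cannot shorten its initial segment of
  -- length `M` either.
  set f := w.getVert M with hf
  have hfv : K.IsLevelVertex (n + 2 * M) f := isLevelVertex_of_walk he (w.take M)
  have h1 : K.levelDist (n + 2 * M) e f ≤ M := by
    refine (SimpleGraph.edist_le (w.take M)).trans ?_
    rw [SimpleGraph.Walk.take_length]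
    exact_mod_cast min_le_left _ _
  have h2 : K.levelDist n (K.transition n f) (K.transition n e') ≤ (w.length - M : ℕ) := by
    refine (levelDist_transition_le_length hK hn (w.drop M)).trans ?_
    rw [SimpleGraph.Walk.drop_length]
  have h3 : (M : ℕ∞) ≤ K.levelDist n (K.transition n e) (K.transition n f) := by
    by_contra hlt
    rw [not_le] at hlt
    obtain ⟨a, ha⟩ := ENat.ne_top_iff_exists.1 hlt.ne_top
    have h4 : K.levelDist n (K.transition n e) (K.transition n e') ≤ (a + (w.length - M) : ℕ) := by
      rw [Nat.cast_add, ha]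
      exact SimpleGraph.edist_triangle.trans (add_le_add le_rfl h2)
    rw [← ha] at hlt
    have h5 : w.length ≤ a + (w.length - M) := by
      rw [levelDist, ← hw] at hcon
      exact_mod_cast hcon.trans h4
    have h6 : a < M := by exact_mod_cast hlt
    omega
  obtain ⟨x, hx, hex⟩ := he.exists_eq_cellAt hK
  obtain ⟨y, hy, hfy⟩ := hfv.exists_eq_cellAt hK
  rw [hex, hfy] at h1 h3
  rw [transition_cellAt hK hn, transition_cellAt hK hn] at h3
  exact absurd (lt_of_levelDist_const hK hδ hx hy h1 h3) (not_lt.2 hM.le)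

/-! ### Bounds for equivalent points of the limit set -/

theorem exists_levelDist_eq_of_equiv (hK : IsFiniteCW K.cw) {δ : ℝ}
    (hδ : IsDeltaHyperbolic K.historyGraph δ) {x y : K.limitSet} (h : K.limitSetoid x y) (n : ℕ) :
    ∃ D : ℕ, K.levelDist n (K.cellAt n x) (K.cellAt n y) = D ∧ (D : ℝ) < δ := by
  obtain ⟨B, hB⟩ := h
  have hx := (mem_limitSet_iff hK).1 x.2
  have hy := (mem_limitSet_iff hK).1 y.2
  have hmono := levelDist_cellAt_mono hK (x : X) y
  have hex : ∀ n, ∃ D : ℕ, (D : ℕ∞) = K.levelDist n (K.cellAt n x) (K.cellAt n y) := fun n =>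
    ENat.ne_top_iff_exists.1 (ne_top_of_le_ne_top (ENat.natCast_ne_top B) (hB n))
  choose D hD using hex
  have hDmono : Monotone D := fun a b hab => by
    have := hmono hab
    simp only [← hD] at this
    exact_mod_cast this
  have hDB : ∀ n, D n ≤ B := fun n => by
    have := hB n
    rw [← hD] at this
    exact_mod_cast this
  -- A bounded sequence of integers attains its maximum, and by monotonicity it is constant from `k`
  -- on, so `L = D k` and `q = k` are admissible.
  obtain ⟨k, hk⟩ : ∃ k, ∀ m, D m ≤ D k := by
    have hfin : (range D).Finite := (finite_Iic B).subset (by rintro _ ⟨m, rfl⟩; exact hDB m)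
    obtain ⟨_, ⟨k, rfl⟩, hk⟩ := hfin.exists_maximal (range_nonempty D)
    exact ⟨k, fun m => (le_total (D m) (D k)).elim id fun h => hk ⟨m, rfl⟩ h⟩
  refine ⟨D n, (hD n).symm, ?_⟩
  have := lt_of_levelDist_const hK hδ (q := k) (L := D k) (hx _) (hy _)
    (by rw [← hD]; exact_mod_cast hk _) (hD k).le
  exact lt_of_le_of_lt (by exact_mod_cast hk n) this

theorem levelDist_le_of_dist_le (hK : IsFiniteCW K.cw) {n C : ℕ} {x y : X}
    (hx : x ∈ K.limitLevel (n + C)) (hy : y ∈ K.limitLevel (n + C))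
    (h : K.historyGraph.dist (vertexAt hK _ hx) (vertexAt hK _ hy) ≤ C) :
    K.levelDist n (K.cellAt n x) (K.cellAt n y) ≤ C := by
  obtain ⟨D, hD, hD'⟩ := exists_levelDist_le_of_dist hK (m := n) (by omega) hx hy (by omega)
  exact hD.trans (by exact_mod_cast (by omega : D ≤ C))

theorem combDiam_fiber_le (hK : IsFiniteCW K.cw) {δ : ℝ}
    (hδ : IsDeltaHyperbolic K.historyGraph δ) (ξ : K.CanonicalQuotient) (n : ℕ) :
    ((K.combDiam n (K.fiber ξ) : ℕ∞) : ENNReal) ≤ ENNReal.ofReal δ := by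
  have h1 : K.combDiam n (K.fiber ξ) ≤ (⌊δ⌋₊ : ℕ) := by
    refine iSup₂_le fun x hx => iSup₂_le fun y hy => ?_
    obtain ⟨D, hD, hDδ⟩ := exists_levelDist_eq_of_equiv hK hδ
      (Quotient.exact (hx.trans (hy : _ = ξ).symm)) n
    rw [hD]
    exact_mod_cast Nat.le_floor hDδ.le
  calc ((K.combDiam n (K.fiber ξ) : ℕ∞) : ENNReal) ≤ ((⌊δ⌋₊ : ℕ∞) : ENNReal) := by
        exact_mod_cast h1
    _ = ENNReal.ofReal (⌊δ⌋₊ : ℝ) := by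
        rw [ENNReal.ofReal_natCast]
        rfl
    _ ≤ ENNReal.ofReal δ := ENNReal.ofReal_le_ofReal (Nat.floor_le hδ.1.le)

/-- Balls are unions of closed cells, so the cell of a point in a ball may be one step further away;
only boundedness matters here. -/
theorem equiv_of_forall_mem_levelBall (hK : IsFiniteCW K.cw) {x y : K.limitSet} {B : ℕ}
    (h : ∀ n, (y : X) ∈ K.levelBall n x B) : K.limitSetoid x y :=
  ⟨B + 1, fun n => levelDist_le_of_mem_levelBall hK (h n)⟩

theorem isConnected_fiber (hK : IsFiniteCW K.cw) {δ : ℝ}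
    (hδ : IsDeltaHyperbolic K.historyGraph δ) (ξ : K.CanonicalQuotient) :
    IsConnected (K.fiber ξ) := by
  have : CompactSpace X := isCompact_of_isFiniteCW hK
  induction ξ using Quotient.inductionOn with | h x => ?_
  refine ⟨⟨x, rfl⟩, ?_⟩
  rw [← IsInducing.subtypeVal.isPreconnected_image]
  have hx := (mem_limitSet_iff hK).1 x.2
  have key : Subtype.val '' K.fiber (Quotient.mk K.limitSetoid x) =
      ⋂ n, K.levelBall n x ⌊δ⌋₊ := by
    ext y
    rw [mem_iInter]
    constructor
    · rintro ⟨y, hy, rfl⟩ n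
      have hxy : K.limitSetoid x y := Quotient.exact (hy : _ = _).symm
      obtain ⟨D, hD, hDδ⟩ := exists_levelDist_eq_of_equiv hK hδ hxy n
      refine mem_levelBall hK ((mem_limitSet_iff hK).1 y.2 n) ?_
      rw [hD]
      exact_mod_cast Nat.le_floor hDδ.le
    · intro hy
      have hyΛ : y ∈ K.limitSet :=
        (mem_limitSet_iff hK).2 fun n => mem_limitLevel_of_mem_levelBall hK (hy n)
      exact ⟨⟨y, hyΛ⟩, (Quotient.sound (s := K.limitSetoid)
        (equiv_of_forall_mem_levelBall hK (y := ⟨y, hyΛ⟩) hy)).symm, rfl⟩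
  rw [key]
  exact isPreconnected_iInter_of_antitone (levelBall_antitone hK x _)
    (fun n => (isClosed_levelBall hK n x _).isCompact)
    fun n => isPreconnected_levelBall hK (hx n) _

end RComplex

/-! ### Rays of a connected graph -/

section Rays

variable {V : Type v} {G : SimpleGraph V} {o : V}

theorem GeodesicRay.dist_start (γ : GeodesicRay G o) (t : ℕ) : G.dist o (γ.toFun t) = t := by
  have := γ.geodesic 0 t t.zero_le
  rwa [γ.start, Nat.sub_zero] at this

theorem GeodesicRay.gromovProduct_eq (γ ν : GeodesicRay G o) (t : ℕ) :
    gromovProduct G o (γ.toFun t) (ν.toFun t) = t - G.dist (γ.toFun t) (ν.toFun t) / 2 := by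
  rw [gromovProduct, γ.dist_start, ν.dist_start]
  ring

theorem GeodesicRay.gromovProduct_self_of_le (γ : GeodesicRay G o) {s t : ℕ} (h : s ≤ t) :
    gromovProduct G o (γ.toFun s) (γ.toFun t) = s := by
  rw [gromovProduct, γ.dist_start, γ.dist_start, γ.geodesic s t h, Nat.cast_sub h]
  ring

theorem gromovProduct_comm (p x y : V) : gromovProduct G p x y = gromovProduct G p y x := by
  rw [gromovProduct, gromovProduct, SimpleGraph.dist_comm (u := x)]
  ring

/-- From time `s` to time `t` the distance of the rays grows by at most `2 * (t - s)`. -/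
theorem GeodesicRay.gromovProduct_mono (hG : G.Connected) (γ ν : GeodesicRay G o) :
    Monotone fun t => gromovProduct G o (γ.toFun t) (ν.toFun t) := by
  intro s t hst
  simp only [gromovProduct_eq]
  have h1 := hG.dist_triangle (u := γ.toFun t) (v := γ.toFun s) (w := ν.toFun t)
  have h2 := hG.dist_triangle (u := γ.toFun s) (v := ν.toFun s) (w := ν.toFun t)
  rw [ν.geodesic s t hst] at h2
  rw [SimpleGraph.dist_comm (u := γ.toFun t) (v := γ.toFun s), γ.geodesic s t hst] at h1
  have h3 : G.dist (γ.toFun t) (ν.toFun t) + 2 * s ≤ G.dist (γ.toFun s) (ν.toFun s) + 2 * t := by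
    omega
  rify at h3
  linarith

theorem GeodesicRay.dist_le_of_le_gromovProduct {δ : ℝ} (hδ : IsDeltaHyperbolic G δ)
    (γ ν : GeodesicRay G o) {k t : ℕ} (hkt : k ≤ t)
    (h : (k : ℝ) ≤ gromovProduct G o (γ.toFun t) (ν.toFun t)) :
    (G.dist (γ.toFun k) (ν.toFun k) : ℝ) ≤ 4 * δ := by
  -- Going from `γ(k)` to `ν(k)` through `γ(t)` and `ν(t)` costs `δ` twice: the Gromov product at
  -- time `k` exceeds `k - 2 * δ`, and the distance is twice its defect.
  have h1 := hδ.2 (γ.toFun k) (γ.toFun t) (ν.toFun k) o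
  have h2 := hδ.2 (γ.toFun t) (ν.toFun t) (ν.toFun k) o
  rw [γ.gromovProduct_self_of_le hkt, gromovProduct_eq] at h1
  rw [gromovProduct_comm o (ν.toFun t), ν.gromovProduct_self_of_le hkt, min_eq_right h] at h2
  have hpos := hδ.1
  rcases min_lt_iff.1 (sub_lt_iff_lt_add.1 h1) with h3 | h3 <;> linarith

theorem RayEquiv.dist_le {δ : ℝ} (hδ : IsDeltaHyperbolic G δ) {γ ν : GeodesicRay G o}
    (h : RayEquiv G o γ ν) (k : ℕ) : (G.dist (γ.toFun k) (ν.toFun k) : ℝ) ≤ 4 * δ := by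
  obtain ⟨t, ht, hkt⟩ := ((h.eventually_ge_atTop (k : ℝ)).and (eventually_ge_atTop k)).exists
  exact γ.dist_le_of_le_gromovProduct hδ ν hkt ht

theorem rayEquiv_of_dist_le {γ ν : GeodesicRay G o} {C : ℝ}
    (h : ∀ k, (G.dist (γ.toFun k) (ν.toFun k) : ℝ) ≤ C) : RayEquiv G o γ ν := by
  rw [RayEquiv]
  simp only [GeodesicRay.gromovProduct_eq]
  refine tendsto_atTop_mono (fun t => sub_le_sub_left (div_le_div_of_nonneg_right (h t) ?_) _)
    (tendsto_atTop_add_const_right _ (-(C / 2)) tendsto_natCast_atTop_atTop)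
  norm_num

theorem equivalence_rayEquiv (hG : G.Connected) {δ : ℝ} (hδ : IsDeltaHyperbolic G δ) :
    Equivalence (RayEquiv G o) where
  refl γ := rayEquiv_of_dist_le (C := 0) fun k => by simp
  symm h := rayEquiv_of_dist_le fun k => by
    rw [SimpleGraph.dist_comm]
    exact h.dist_le hδ k
  trans {a b c} h h' := rayEquiv_of_dist_le (C := 4 * δ + 4 * δ) fun k => by
    have h1 := hG.dist_triangle (u := a.toFun k) (v := b.toFun k) (w := c.toFun k)
    rify at h1
    linarith [h.dist_le hδ k, h'.dist_le hδ k]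

theorem mk_rayEquiv_eq_iff (hG : G.Connected) {δ : ℝ} (hδ : IsDeltaHyperbolic G δ)
    {γ ν : GeodesicRay G o} :
    Quot.mk (RayEquiv G o) γ = Quot.mk (RayEquiv G o) ν ↔ RayEquiv G o γ ν :=
  (equivalence_rayEquiv hG hδ).quot_mk_eq_iff γ ν

end Rays

namespace RComplex

variable {N : ℕ} {S : Type u} [TopologicalSpace S] [T2Space S] {R : SubdivisionRule N S}
  {X : Type v} [TopologicalSpace X] [T2Space X] {K : RComplex R X}

/-! ### The homeomorphism of the canonical quotient with the Gromov boundary -/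

/-- The ray of the cells that contain a given point of the limit set. -/
def rayAt (hK : IsFiniteCW K.cw) (x : K.limitSet) : GeodesicRay K.historyGraph none where
  toFun
    | 0 => none
    | n + 1 => vertexAt hK n ((mem_limitSet_iff hK).1 x.2 n)
  start := rfl
  geodesic
    | 0, j, _ => by
      rw [dist_origin hK]
      cases j <;> rfl
    | i + 1, j + 1, hij => by
      dsimp only
      rw [dist_vertexAt hK (by omega)]
      omega

theorem dist_rayAt_le_of_levelDist_le (hK : IsFiniteCW K.cw) {x y : K.limitSet} {n C : ℕ}
    (h : K.levelDist n (K.cellAt n x) (K.cellAt n y) ≤ C) :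
    K.historyGraph.dist ((rayAt hK x).toFun (n + 1)) ((rayAt hK y).toFun (n + 1)) ≤ C :=
  dist_le_of_levelDist_le hK ((mem_limitSet_iff hK).1 x.2 n) ((mem_limitSet_iff hK).1 y.2 n) h

theorem rayEquiv_rayAt_iff (hK : IsFiniteCW K.cw) {δ : ℝ}
    (hδ : IsDeltaHyperbolic K.historyGraph δ) {x y : K.limitSet} :
    RayEquiv K.historyGraph none (rayAt hK x) (rayAt hK y) ↔ K.limitSetoid x y := by
  constructor
  · intro h
    refine ⟨⌊4 * δ⌋₊, fun n => ?_⟩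
    -- Rays are compared `⌊4 * δ⌋₊` levels deeper than `n`, so that the connecting geodesic projects
    -- to level `n`. The extra 1 accounts for the origin: level `n` is reached at time `n + 1`.
    exact levelDist_le_of_dist_le hK ((mem_limitSet_iff hK).1 x.2 _)
      ((mem_limitSet_iff hK).1 y.2 _) (Nat.le_floor (h.dist_le hδ (n + ⌊4 * δ⌋₊ + 1)))
  · rintro ⟨B, hB⟩
    refine rayEquiv_of_dist_le (C := B) fun k => ?_
    cases k with
    | zero => simp [rayAt]
    | succ k => exact_mod_cast dist_rayAt_le_of_levelDist_le hK (hB k)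

/-- The cells of a ray are nested, and the ray stays close to a point in all their closures. -/
theorem exists_dist_rayAt_le (hK : IsFiniteCW K.cw) (γ : GeodesicRay K.historyGraph none) :
    ∃ x : K.limitSet, ∀ k, K.historyGraph.dist (γ.toFun k) ((rayAt hK x).toFun k) ≤ 1 := by
  have : CompactSpace X := isCompact_of_isFiniteCW hK
  have hv : ∀ k, ∃ (z : X) (hz : z ∈ K.limitLevel k), γ.toFun (k + 1) = vertexAt hK k hz := by
    intro k
    have h := γ.dist_start (k + 1)
    rw [dist_origin hK] at h
    generalize γ.toFun (k + 1) = v at h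
    rcases v with _ | v
    · simp [height] at h
    · obtain ⟨z, hz, e⟩ := exists_eq_vertexAt hK v
      simp only [height] at h
      obtain rfl : v.1 = k := by omega
      exact ⟨z, hz, e⟩
  choose z hz hγ using hv
  have hsub : ∀ k, K.cellAt (k + 1) (z (k + 1)) ⊆ K.cellAt k (z k) := by
    intro k
    have h := γ.geodesic (k + 1) (k + 1 + 1) (by omega)
    -- Consecutive vertices lie on consecutive levels, so their edge is vertical and the cells are
    -- nested.
    rw [hγ, hγ, Nat.add_sub_cancel_left, SimpleGraph.dist_eq_one_iff_adj] at h
    rcases h with ⟨h, -⟩ | ⟨-, h⟩ | ⟨h, -⟩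
    · dsimp only at h
      omega
    · exact h
    · dsimp only at h
      omega
  obtain ⟨x, hx⟩ := IsCompact.nonempty_iInter_of_sequence_nonempty_isCompact_isClosed
    (fun k => closure (K.cellAt k (z k))) (fun k => closure_mono (hsub k))
    (fun k => ⟨z k, subset_closure ((K.isCellular_cellAt hK k).mem_self _)⟩)
    isClosed_closure.isCompact (fun k => isClosed_closure)
  rw [mem_iInter] at hx
  have hxΛ : x ∈ K.limitSet := (mem_limitSet_iff hK).2 fun k =>
    closure_minimal (cellAt_subset_limitLevel hK (hz k)) (isClosed_limitLevel hK k) (hx k)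
  refine ⟨⟨x, hxΛ⟩, fun k => ?_⟩
  cases k with
  | zero => simp [rayAt, γ.start]
  | succ k =>
    rw [hγ]
    exact dist_le_of_levelDist_le hK _ ((mem_limitSet_iff hK).1 hxΛ k)
      ((levelDist_cellAt_le_one hK (hz k) (hx k)).trans (by simp))

/-- The point of the Gromov boundary determined by a point of the limit set. -/
def boundaryPoint (hK : IsFiniteCW K.cw) (x : K.limitSet) :
    GromovBoundary K.historyGraph none :=
  Quot.mk _ (rayAt hK x)

theorem boundaryPoint_eq_iff (hK : IsFiniteCW K.cw) {δ : ℝ}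
    (hδ : IsDeltaHyperbolic K.historyGraph δ) {x y : K.limitSet} :
    boundaryPoint hK x = boundaryPoint hK y ↔ K.limitSetoid x y :=
  (mk_rayEquiv_eq_iff (historyGraph_connected hK) hδ).trans (rayEquiv_rayAt_iff hK hδ)

theorem surjective_boundaryPoint (hK : IsFiniteCW K.cw) :
    Function.Surjective (boundaryPoint hK) := by
  rintro ⟨γ⟩
  obtain ⟨x, hx⟩ := exists_dist_rayAt_le hK γ
  refine ⟨x, (Quot.sound (rayEquiv_of_dist_le (C := 1) fun k => ?_)).symm⟩
  exact_mod_cast hx k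

/-- The open cells of `R^n(X)` whose closure contains `x` form a neighborhood of `x`. -/
theorem eventually_mem_closure_cellAt (hK : IsFiniteCW K.cw) (n : ℕ) (x : X) :
    ∀ᶠ y in 𝓝 x, x ∈ closure (K.cellAt n y) := by
  have H := K.isCellular_cellAt hK n
  have hcl : IsClosed (⋃ e ∈ {e ∈ range (K.cellAt n) | x ∉ closure e}, closure e) :=
    (H.finite.subset (sep_subset _ _)).isClosed_biUnion fun _ _ => isClosed_closure
  have hx : x ∉ ⋃ e ∈ {e ∈ range (K.cellAt n) | x ∉ closure e}, closure e := by
    simp only [mem_iUnion, exists_prop, not_exists, not_and]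
    exact fun e he => he.2
  filter_upwards [hcl.isOpen_compl.mem_nhds hx] with y hy
  by_contra hn
  exact hy (mem_biUnion (x := K.cellAt n y) ⟨⟨y, rfl⟩, hn⟩ (subset_closure (H.mem_self y)))

theorem continuous_boundaryPoint (hK : IsFiniteCW K.cw) : Continuous (boundaryPoint hK) := by
  refine ⟨fun W hW => isOpen_iff_mem_nhds.2 fun x hx => ?_⟩
  obtain ⟨r, hr⟩ := hW (rayAt hK x) hx
  obtain ⟨n, hn⟩ := exists_nat_ge r
  -- For `y` near `x` the level-`n` cells are equal or adjacent, so the Gromov product is at least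
  -- `n + 1 - 1/2 ≥ r` at time `n + 1` and, by monotonicity, afterwards.
  filter_upwards [continuousAt_subtype_val.eventually
    (eventually_mem_closure_cellAt hK n (x : X))] with y hy
  refine hr ⟨rayAt hK y, rfl, ?_⟩
  filter_upwards [eventually_ge_atTop (n + 1)] with t ht
  refine le_trans ?_ (GeodesicRay.gromovProduct_mono (historyGraph_connected hK) _ _ ht)
  have h1 := levelDist_cellAt_le_one hK ((mem_limitSet_iff hK).1 y.2 n) hy
  rw [levelDist, SimpleGraph.edist_comm] at h1
  have h2 := dist_rayAt_le_of_levelDist_le hK (x := x) (y := y) (C := 1) (by exact_mod_cast h1)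
  dsimp only
  rw [GeodesicRay.gromovProduct_eq]
  rify at h2
  push_cast
  linarith

/-- A boundary point close to that of `x` comes from points of the limit set whose cells are close
to those of `x` on many levels. -/
theorem levelDist_le_of_mem_boundaryNhd (hK : IsFiniteCW K.cw) {δ : ℝ}
    (hδ : IsDeltaHyperbolic K.historyGraph δ) {γ : GeodesicRay K.historyGraph none}
    {x y : K.limitSet} (hγ : boundaryPoint hK x = Quot.mk _ γ) {m : ℕ}
    (h : boundaryPoint hK y ∈
      boundaryNhd K.historyGraph none γ (m + ⌊12 * δ⌋₊ + 1 : ℕ)) :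
    K.levelDist m (K.cellAt m x) (K.cellAt m y) ≤ ⌊12 * δ⌋₊ := by
  obtain ⟨ν, hν, hev⟩ := h
  have hG := historyGraph_connected hK
  set k := m + ⌊12 * δ⌋₊ + 1 with hk
  obtain ⟨t, ht, hkt⟩ := (hev.and (eventually_ge_atTop k)).exists
  have h1 := γ.dist_le_of_le_gromovProduct hδ ν hkt ht
  -- The constant 12 is three times 4: from the ray of `x` to `γ`, from `γ` to `ν`, and from `ν` to
  -- the ray of `y`.
  have h2 := ((mk_rayEquiv_eq_iff hG hδ).1 hγ).dist_le hδ k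
  have h3 := ((mk_rayEquiv_eq_iff hG hδ).1 hν).dist_le hδ k
  have h4 := hG.dist_triangle (u := (rayAt hK x).toFun k) (v := γ.toFun k)
    (w := (rayAt hK y).toFun k)
  have h5 := hG.dist_triangle (u := γ.toFun k) (v := ν.toFun k) (w := (rayAt hK y).toFun k)
  rify at h4 h5
  exact levelDist_le_of_dist_le hK ((mem_limitSet_iff hK).1 x.2 _)
    ((mem_limitSet_iff hK).1 y.2 _) (Nat.le_floor (by
      change (K.historyGraph.dist ((rayAt hK x).toFun k) ((rayAt hK y).toFun k) : ℝ) ≤ 12 * δ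
      linarith))

theorem isClosedMap_boundaryPoint (hK : IsFiniteCW K.cw) {δ : ℝ}
    (hδ : IsDeltaHyperbolic K.historyGraph δ) : IsClosedMap (boundaryPoint hK) := by
  have : CompactSpace X := isCompact_of_isFiniteCW hK
  intro P hP
  rw [← isOpen_compl_iff]
  intro γ hγ
  by_contra! hcon
  obtain ⟨x, hx⟩ := surjective_boundaryPoint hK (Quot.mk _ γ)
  have hPX : IsClosed (Subtype.val '' P : Set X) :=
    isClosed_limitSet.isClosedEmbedding_subtypeVal.isClosedMap P hP
  -- If every neighborhood of `[γ]` meets the image of `P`, then `P` meets the ball around `x` on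
  -- every level. A common point lies in `P` and is equivalent to `x`, so `[γ]` is itself in the
  -- image.
  obtain ⟨y, hy⟩ := IsCompact.nonempty_iInter_of_sequence_nonempty_isCompact_isClosed
    (fun m => Subtype.val '' P ∩ K.levelBall m x ⌊12 * δ⌋₊)
    (fun m => inter_subset_inter_right _ (levelBall_antitone hK x _ m.le_succ))
    (fun m => by
      obtain ⟨ξ, hξ, hξP⟩ := not_subset.1 (hcon (m + ⌊12 * δ⌋₊ + 1 : ℕ))
      obtain ⟨y, hyP, rfl⟩ := not_not.1 hξP
      exact ⟨y, ⟨y, hyP, rfl⟩, mem_levelBall hK ((mem_limitSet_iff hK).1 y.2 m)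
        (levelDist_le_of_mem_boundaryNhd hK hδ hx hξ)⟩)
    (hPX.inter (isClosed_levelBall hK 0 x _)).isCompact
    (fun m => hPX.inter (isClosed_levelBall hK m x _))
  rw [mem_iInter] at hy
  obtain ⟨y, hyP, rfl⟩ := (hy 0).1
  have hxy := equiv_of_forall_mem_levelBall hK fun m => (hy m).2
  exact hγ ⟨y, hyP, ((boundaryPoint_eq_iff hK hδ).2 hxy).symm.trans hx⟩

/-- The canonical quotient is homeomorphic to the Gromov boundary of the history graph. -/
def canonicalQuotientHomeomorph (hK : IsFiniteCW K.cw) {δ : ℝ}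
    (hδ : IsDeltaHyperbolic K.historyGraph δ) :
    K.CanonicalQuotient ≃ₜ GromovBoundary K.historyGraph none :=
  Equiv.toHomeomorphOfContinuousClosed
    (Equiv.ofBijective (Quotient.lift (boundaryPoint hK)
        fun _ _ h => (boundaryPoint_eq_iff hK hδ).2 h)
      ⟨by
        rintro ⟨x⟩ ⟨y⟩ h
        exact Quotient.sound ((boundaryPoint_eq_iff hK hδ).1 h),
      fun ξ =>
        let ⟨x, hx⟩ := surjective_boundaryPoint hK ξ
        ⟨Quotient.mk _ x, hx⟩⟩)
    ((continuous_boundaryPoint hK).quotient_lift _)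
    (by
      intro C hC
      have hC' : IsClosed (Quotient.mk K.limitSetoid ⁻¹' C) := hC.preimage continuous_quotient_mk'
      convert isClosedMap_boundaryPoint hK hδ _ hC' using 1
      conv_lhs => rw [← image_preimage_eq C Quotient.mk_surjective, image_image]
      rfl)

end RComplex

end

theorem mainTheorem2 {N : ℕ} {S : Type u} [TopologicalSpace S] [T2Space S]
    (R : SubdivisionRule N S) {X : Type v} [TopologicalSpace X] [T2Space X]
    (K : RComplex R X) (hK : IsFiniteCW K.cw)
    (δ : ℝ) (hδ : IsDeltaHyperbolic K.historyGraph δ) :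
    K.IsHyperbolicWrt ∧
    Nonempty (K.CanonicalQuotient ≃ₜ GromovBoundary K.historyGraph none) ∧
    ∀ ξ : K.CanonicalQuotient, IsConnected (K.fiber ξ) ∧
      ∀ n : ℕ, ((K.combDiam n (K.fiber ξ) : ℕ∞) : ENNReal) ≤ ENNReal.ofReal (δ + 1) :=
  ⟨RComplex.isHyperbolicWrt hK hδ, ⟨RComplex.canonicalQuotientHomeomorph hK hδ⟩, fun ξ =>
    ⟨RComplex.isConnected_fiber hK hδ ξ, fun n => (RComplex.combDiam_fiber_le hK hδ ξ n).trans
      (ENNReal.ofReal_le_ofReal (by linarith))⟩⟩
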